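/- Let $n_A,n_B\ge 1$ and $n=\min\{n_A,n_B\}$. Let $\mathcal H_k$ be the real vector space of Hermitian $k\times k$ complex matrices, with the cone $\mathrm{PSD}_k$ and the unit effect $u_k=\mathrm{Tr}$. The bipartite $W$-theory with local Hilbert spaces $\mathbb C^{n_A},\mathbb C^{n_B}$ is the general probabilistic theory $(V,C,u)$ with $V=\mathcal H_{n_A}\otimes_{\mathbb R}\mathcal H_{n_B}$, $C=\mathrm{conv}\{P\otimes Q:\ P\in\mathrm{PSD}_{n_A},\,Q\in\mathrm{PSD}_{n_B}\}$ and $u=u_{n_A}\otimes u_{n_B}$. In a theory $(V,C,u)$, the dual cone is $C^*=\{f\in V^*: f\ge 0\text{ on }C\}$, a state is an $\omega\in C$ with $u(\omega)=1$, an effect is an $e\in V^*$ with $e\in C^*$ and $u-e\in C^*$, and a measurement is a finite family of effects with sum $u$; $\mathbf M$ is the set of all measurements. A set $\mathcal M\subseteq\mathbf M$ is informationally complete if the effects of its members span $V^*$. For such $\mathcal M$ put $$\|x\|_{\mathcal M}=\sup_{(e_i)_i\in\mathcal M}\sum_i|e_i(x)|,\qquad P_e^{\mathcal M}(\rho,\sigma;p)=\tfrac12\bigl(1-\|p\rho-(1-p)\sigma\|_{\mathcal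 M}\bigr).$$ There is data hiding against $\mathcal M$ with efficiency $R\ge1$ if there are states $\rho,\sigma$ and $p\in[0,1]$ with $P_e^{\mathbf M}(\rho,\sigma;p)=0$ and $P_e^{\mathcal M}(\rho,\sigma;p)=\frac12(1-\frac1R)$. The data hiding ratio $R(\mathcal M)$ is the highest efficiency of data hiding against $\mathcal M$. In the bipartite $W$-theory, let $\mathrm{SEP}$ be the set of measurements all of whose effects lie in $\mathrm{conv}\{e\otimes f:\ e\in\mathrm{PSD}_{n_A}^*,\ f\in\mathrm{PSD}_{n_B}^*\}$. Let $\mathrm{LOCC}_{A\to B}$ be the set of all coarse grainings (grouping outcomes and adding up the effects in each group) of families $(e_i\otimes f^{(i)}_j)_{(i,j)\in I\times J}$, where $(e_i)_{i\in I}$ is a measurement on $A$ and, for each $i$, $(f^{(i)}_j)_{j\in J}$ is a measurement on $B$. The set $\mathrm{LOCC}_{B\to A}$ is defined in the same way with the two parties exchanged. Let $\mathrm{LOCC}_\to$ be the one of these with communication from the smaller to the larger subsystem (either of them if $n_A=n_B$). **Proposition.** $\mathrm{SEP}$ and $\mathrm{LOCC}_\to$ are informationally complete sets of measurements of the bipartite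 $W$-theory, and their data hiding ratios (which are attained) are $$R_W(\mathrm{SEP})=R_W(\mathrm{LOCC}_\to)=2n-1 .$$ -/

import Mathlib

open scoped TensorProduct ComplexOrder

noncomputable section

namespace WTheory

/-- The data `(V, C, u)` of a general probabilistic theory: a cone `C` of unnormalised states in a
real vector space `V` and a unit effect `u`. It is only applied below to quantum systems and to
their minimal tensor products, where the cone is built explicitly. -/
structure GPTData (V : Type) [AddCommGroup V] [Module ℝ V] where
  cone : Set V
  unit : Module.Dual ℝ V

/-- A finite family of linear functionals on `V` (the candidates for measurements). -/
structure FinFamily (V : Type) [AddCommGroup V] [Module ℝ V] where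
  ι : Type
  [fintype : Fintype ι]
  effect : ι → Module.Dual ℝ V

attribute [instance] FinFamily.fintype

section General

variable {V : Type} [AddCommGroup V] [Module ℝ V]

/-- The dual cone `K* = {f : f(a) ≥ 0 for all a ∈ K}`. -/
def dualCone (K : Set V) : Set (Module.Dual ℝ V) := {f | ∀ a ∈ K, 0 ≤ f a}

/-- The normalised states. -/
def GPTData.states (G : GPTData V) : Set V := {x | x ∈ G.cone ∧ G.unit x = 1}

/-- The interval `[0, u]` of effects, for the order given by the dual cone. -/
def GPTData.effects (G : GPTData V) : Set (Module.Dual ℝ V) :=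
  {e | e ∈ dualCone G.cone ∧ G.unit - e ∈ dualCone G.cone}

/-- A family `(e_i)_{i ∈ I}` of effects that sum up to the unit. -/
def GPTData.IsMeasurement (G : GPTData V) {I : Type} [Fintype I]
    (e : I → Module.Dual ℝ V) : Prop :=
  (∀ i, e i ∈ G.effects) ∧ ∑ i, e i = G.unit

/-- The set of all measurements. -/
def GPTData.measurements (G : GPTData V) : Set (FinFamily V) := {F | G.IsMeasurement F.effect}

/-- The effects occurring in the measurements of `M` span the dual space. -/
def IsInformationallyComplete (M : Set (FinFamily V)) : Prop :=
  Submodule.span ℝ {g : Module.Dual ℝ V | ∃ F ∈ M, ∃ i, g = F.effect i} = ⊤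

open Classical in
/-- Coarse graining: the outcomes of a measurement of `M` are grouped into (possibly empty)
blocks, the fibres of `π`, and the effects in each block are added. -/
def coarseGraining (M : Set (FinFamily V)) : Set (FinFamily V) :=
  {F | ∃ F' ∈ M, ∃ π : F'.ι → F.ι,
    ∀ j, F.effect j = ∑ i ∈ Finset.univ.filter (fun i => π i = j), F'.effect i}

/-- The distinguishability norm `‖x‖_M = sup_{(e_i) ∈ M} ∑_i |e_i(x)|`. -/
def distNorm (M : Set (FinFamily V)) (x : V) : ℝ :=
  sSup {r : ℝ | ∃ F ∈ M, r = ∑ i, |F.effect i x|}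

/-- The lowest probability of error in discriminating `ρ` and `σ`, with a priori probabilities
`p` and `1 - p`, by measurements of `M`. -/
def errorProb (M : Set (FinFamily V)) (ρ σ : V) (p : ℝ) : ℝ :=
  1 / 2 * (1 - distNorm M (p • ρ - (1 - p) • σ))

/-- There is data hiding against `M` with efficiency `R`. -/
def GPTData.HasDataHiding (G : GPTData V) (M : Set (FinFamily V)) (R : ℝ) : Prop :=
  1 ≤ R ∧ ∃ ρ ∈ G.states, ∃ σ ∈ G.states, ∃ p ∈ Set.Icc (0 : ℝ) 1,
    errorProb G.measurements ρ σ p = 0 ∧ errorProb M ρ σ p = 1 / 2 * (1 - 1 / R)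

/-- `R` is the data hiding ratio against `M`: the set `M` consists of measurements and is
informationally complete, and `R` is the highest efficiency of data hiding against `M`. -/
def GPTData.IsDataHidingRatio (G : GPTData V) (M : Set (FinFamily V)) (R : ℝ) : Prop :=
  M ⊆ G.measurements ∧ IsInformationallyComplete M ∧ IsGreatest {r | G.HasDataHiding M r} R

end General

section Bipartite

variable {V W : Type} [AddCommGroup V] [Module ℝ V] [AddCommGroup W] [Module ℝ W]

/-- The product functional `e ⊗ f` on `V ⊗ W`, with `(e ⊗ f)(a ⊗ b) = e(a) f(b)`. -/
def prodFunctional (e : Module.Dual ℝ V) (f : Module.Dual ℝ W) : Module.Dual ℝ (V ⊗[ℝ] W) :=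
  TensorProduct.dualDistrib ℝ V W (e ⊗ₜ[ℝ] f)

/-- The minimal tensor product of two theories: the cone is the convex hull of the product
vectors `a ⊗ b` with `a ∈ C_A`, `b ∈ C_B`, and the unit is `u_A ⊗ u_B`. -/
def GPTData.minTensor (A : GPTData V) (B : GPTData W) : GPTData (V ⊗[ℝ] W) where
  cone := convexHull ℝ {z | ∃ a ∈ A.cone, ∃ b ∈ B.cone, z = a ⊗ₜ[ℝ] b}
  unit := prodFunctional A.unit B.unit

/-- The minimal tensor product `C_A* ⊗_min C_B*` of the dual cones. -/
def separableEffectCone (A : GPTData V) (B : GPTData W) : Set (Module.Dual ℝ (V ⊗[ℝ] W)) :=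
  convexHull ℝ {g | ∃ e ∈ dualCone A.cone, ∃ f ∈ dualCone B.cone, g = prodFunctional e f}

/-- `SEP`: the measurements on the minimal composite all of whose effects are separable. -/
def SEP (A : GPTData V) (B : GPTData W) : Set (FinFamily (V ⊗[ℝ] W)) :=
  {F | F ∈ (A.minTensor B).measurements ∧ ∀ i, F.effect i ∈ separableEffectCone A B}

/-- One-way `LOCC` measurements with communication from `A` to `B`. -/
def LOCCAtoB (A : GPTData V) (B : GPTData W) : Set (FinFamily (V ⊗[ℝ] W)) :=
  coarseGraining
    {F | ∃ (I J : Type) (_ : Fintype I) (_ : Fintype J)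
      (e : I → Module.Dual ℝ V) (f : I → J → Module.Dual ℝ W),
      A.IsMeasurement e ∧ (∀ i, B.IsMeasurement (f i)) ∧
      F = { ι := I × J, effect := fun q => prodFunctional (e q.1) (f q.1 q.2) }}

/-- One-way `LOCC` measurements with communication from `B` to `A`. -/
def LOCCBtoA (A : GPTData V) (B : GPTData W) : Set (FinFamily (V ⊗[ℝ] W)) :=
  coarseGraining
    {F | ∃ (I J : Type) (_ : Fintype I) (_ : Fintype J)
      (e : J → I → Module.Dual ℝ V) (f : J → Module.Dual ℝ W),
      (∀ j, A.IsMeasurement (e j)) ∧ B.IsMeasurement f ∧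
      F = { ι := I × J, effect := fun q => prodFunctional (e q.2 q.1) (f q.2) }}

end Bipartite

/-- The real vector space of `n × n` complex Hermitian matrices. -/
abbrev Herm (n : ℕ) : Type := selfAdjoint (Matrix (Fin n) (Fin n) ℂ)

/-- `n`-level quantum mechanics: Hermitian matrices, the positive semidefinite cone, the trace. -/
def QM (n : ℕ) : GPTData (Herm n) where
  cone := {X | (X : Matrix (Fin n) (Fin n) ℂ).PosSemidef}
  unit :=
    { toFun := fun X => (Matrix.trace (X : Matrix (Fin n) (Fin n) ℂ)).re
      map_add' := fun X Y => by simp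
      map_smul' := fun c X => by simp }

/-- The bipartite `W`-theory: two quantum systems composed by the minimal tensor product. -/
def W (nA nB : ℕ) : GPTData (Herm nA ⊗[ℝ] Herm nB) := (QM nA).minTensor (QM nB)

end WTheory

end

/-! Both bounds rest on a complex projective 2-design: rank-one projections `P k` with weights `w k`
satisfying `∑ k, w k ⟨P k, a⟩ P k = Tr(a) 1 + a`.

Upper bound (`exists_local_decomposition`). Let `m` be the dimension of the smaller system.
Measuring it with the effects `w k / (m+1) ⟨P k, ·⟩` and then applying a suitable two-outcome
measurement on the other side realises `((m-1) u + e) / (2m-1)` for every effect `e`. The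
two-outcome measurement of this noisy effect has bias `(2e - u) / (2m-1)`, so restricting to one-way
LOCC, and hence to SEP, costs at most a factor `2m-1` in the distinguishability norm
(`distNorm_measurements_le`).

Lower bound (`exists_hiding_states`). Let `F` be the flip on `ℂⁿ ⊗ ℂⁿ`, embedded isometrically in
the two systems. The vectors `1 + F` and `n·1 - F` are separable, and the functional `a ⊗ b ↦
Tr(ab)`, an effect of the `W`-theory, separates them perfectly. With the right prior their weighted
difference is `F / (n(2n-1))`. Since `Tr(F (a ⊗ b)) = Tr(ab) ≥ 0`, it is nonnegative on separable
effects, so every separable measurement yields only the value of the unit, `1/(2n-1)`.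
`isDataHidingRatio_of` combines the two bounds. -/

noncomputable section

namespace WTheory

open Matrix

/-! ### Self-duality of the positive semidefinite cone under the trace pairing. -/

section Pairing

variable {n m : ℕ}

/-- The Hilbert–Schmidt pairing `⟨a, b⟩ = Re Tr (a b)` of Hermitian matrices. -/
def pairing (n : ℕ) : Herm n →ₗ[ℝ] Herm n →ₗ[ℝ] ℝ :=
  LinearMap.mk₂ ℝ (fun a b => ((a : Matrix (Fin n) (Fin n) ℂ) * b).trace.re)
    (fun a b c => by simp [add_mul]) (fun r a b => by simp)
    (fun a b c => by simp [mul_add]) (fun r a b => by simp)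

theorem pairing_apply (a b : Herm n) :
    pairing n a b = ((a : Matrix (Fin n) (Fin n) ℂ) * b).trace.re := rfl

theorem QM_unit_apply (a : Herm n) :
    (QM n).unit a = (a : Matrix (Fin n) (Fin n) ℂ).trace.re := rfl

theorem mem_QM_cone {a : Herm n} :
    a ∈ (QM n).cone ↔ (a : Matrix (Fin n) (Fin n) ℂ).PosSemidef := Iff.rfl

theorem Herm.conjTranspose_coe (a : Herm n) :
    (a : Matrix (Fin n) (Fin n) ℂ)ᴴ = a := a.2

theorem pairing_comm (a b : Herm n) : pairing n a b = pairing n b a := by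
  rw [pairing_apply, pairing_apply, trace_mul_comm]

theorem pairing_one_left (a : Herm n) : pairing n 1 a = (QM n).unit a := by
  rw [pairing_apply, QM_unit_apply]; simp

theorem pairing_one_right (a : Herm n) : pairing n a 1 = (QM n).unit a := by
  rw [pairing_comm, pairing_one_left]

theorem QM_unit_one : (QM n).unit 1 = n := by
  rw [QM_unit_apply]; simp

theorem ofReal_pairing (a b : Herm n) :
    ((pairing n a b : ℝ) : ℂ) = ((a : Matrix (Fin n) (Fin n) ℂ) * b).trace := by
  rw [pairing_apply]
  apply Complex.conj_eq_iff_re.1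
  rw [starRingEnd_apply, ← trace_conjTranspose, conjTranspose_mul, a.conjTranspose_coe,
    b.conjTranspose_coe, trace_mul_comm]

theorem ofReal_QM_unit (a : Herm n) :
    (((QM n).unit a : ℝ) : ℂ) = (a : Matrix (Fin n) (Fin n) ℂ).trace := by
  rw [← pairing_one_left, ofReal_pairing]; simp

/-- With `a = c* c`, cyclicity turns `Tr(ab)` into the trace of the positive matrix `c b c*`. -/
theorem pairing_nonneg {a b : Herm n} (ha : a ∈ (QM n).cone) (hb : b ∈ (QM n).cone) :
    0 ≤ pairing n a b := by
  open scoped MatrixOrder in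
  obtain ⟨c, hc⟩ := CStarAlgebra.nonneg_iff_eq_star_mul_self.mp (mem_QM_cone.1 ha).nonneg
  have h : ((a : Matrix (Fin n) (Fin n) ℂ) * b).trace
      = (c * (b : Matrix (Fin n) (Fin n) ℂ) * cᴴ).trace := by
    rw [hc, star_eq_conjTranspose, mul_assoc, trace_mul_comm]
  rw [pairing_apply, h]
  exact (Complex.nonneg_iff.1 ((mem_QM_cone.1 hb).mul_mul_conjTranspose_same c).trace_nonneg).1

theorem QM_unit_nonneg {a : Herm n} (ha : a ∈ (QM n).cone) : 0 ≤ (QM n).unit a :=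
  (Complex.nonneg_iff.1 (mem_QM_cone.1 ha).trace_nonneg).1

/-- In an eigenbasis of `a` the eigenvalues are nonnegative, so each is at most their sum, the
trace. -/
theorem smul_one_sub_mem_QM_cone {a : Herm n} (ha : a ∈ (QM n).cone) :
    (QM n).unit a • (1 : Herm n) - a ∈ (QM n).cone := by
  have hA := mem_QM_cone.1 ha
  set A : Matrix (Fin n) (Fin n) ℂ := (a : Matrix (Fin n) (Fin n) ℂ) with hAdef
  have hs := hA.1.spectral_theorem
  have htr : (QM n).unit a = ∑ i, hA.1.eigenvalues i := by
    rw [QM_unit_apply, ← hAdef, hA.1.trace_eq_sum_eigenvalues]; simp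
  have key : (((QM n).unit a • (1 : Herm n) - a : Herm n) : Matrix (Fin n) (Fin n) ℂ)
      = (hA.1.eigenvectorUnitary : Matrix (Fin n) (Fin n) ℂ)
        * diagonal (fun i => (((∑ j, hA.1.eigenvalues j) - hA.1.eigenvalues i : ℝ) : ℂ))
        * (hA.1.eigenvectorUnitary : Matrix (Fin n) (Fin n) ℂ)ᴴ := by
    have hd : diagonal (fun i => (((∑ j, hA.1.eigenvalues j) - hA.1.eigenvalues i : ℝ) : ℂ))
        = ((∑ j, hA.1.eigenvalues j : ℝ) : ℂ) • (1 : Matrix (Fin n) (Fin n) ℂ)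
          - diagonal (RCLike.ofReal ∘ hA.1.eigenvalues) := by
      ext i j
      by_cases h : i = j <;> simp [h, one_apply]
    have hu : (hA.1.eigenvectorUnitary : Matrix (Fin n) (Fin n) ℂ)
        * (hA.1.eigenvectorUnitary : Matrix (Fin n) (Fin n) ℂ)ᴴ = 1 :=
      Unitary.coe_mul_star_self _
    rw [hd, mul_sub, sub_mul, mul_smul_comm, mul_one, smul_mul_assoc, hu, ← htr]
    rw [Unitary.conjStarAlgAut_apply, star_eq_conjTranspose] at hs
    rw [← hs]
    ext i j
    simp [hAdef]
  rw [mem_QM_cone, key]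
  refine PosSemidef.mul_mul_conjTranspose_same (PosSemidef.diagonal fun i => ?_) _
  have : hA.1.eigenvalues i ≤ ∑ j, hA.1.eigenvalues j :=
    Finset.single_le_sum (f := hA.1.eigenvalues) (fun j _ => hA.eigenvalues_nonneg j)
      (Finset.mem_univ i)
  exact Complex.zero_le_real.2 (sub_nonneg.2 this)

/-- This bound is what keeps the flip functional below the unit on product vectors. -/
theorem pairing_le {a b : Herm n} (ha : a ∈ (QM n).cone) (hb : b ∈ (QM n).cone) :
    pairing n a b ≤ (QM n).unit a * (QM n).unit b := by
  have h := pairing_nonneg (smul_one_sub_mem_QM_cone ha) hb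
  rw [map_sub, map_smul, LinearMap.sub_apply, LinearMap.smul_apply, pairing_one_left,
    smul_eq_mul] at h
  linarith

theorem pairing_injective : Function.Injective (pairing n) := by
  rw [injective_iff_map_eq_zero]
  intro a ha
  have h : ((a : Matrix (Fin n) (Fin n) ℂ)ᴴ * a).trace = 0 := by
    rw [a.conjTranspose_coe, ← ofReal_pairing, ha]; simp
  exact Subtype.ext (trace_conjTranspose_mul_self_eq_zero_iff.1 h)

instance : FiniteDimensional ℝ (Herm n) :=
  inferInstanceAs (FiniteDimensional ℝ (selfAdjoint.submodule ℝ (Matrix (Fin n) (Fin n) ℂ)))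

theorem exists_pairing_eq (f : Module.Dual ℝ (Herm n)) : ∃ b, pairing n b = f :=
  (LinearMap.injective_iff_surjective_of_finrank_eq_finrank
    (Subspace.dual_finrank_eq (K := ℝ) (V := Herm n)).symm).1 pairing_injective f

/-- Testing against the rank-one matrices `v v*` recovers the quadratic form of `b`. -/
theorem mem_QM_cone_of_pairing_mem_dualCone {b : Herm n}
    (h : pairing n b ∈ dualCone (QM n).cone) : b ∈ (QM n).cone := by
  rw [mem_QM_cone]
  refine PosSemidef.of_dotProduct_mulVec_nonneg b.2 fun v => ?_
  let q : Herm n := ⟨vecMulVec v (star v), (posSemidef_vecMulVec_self_star v).1⟩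
  have hq := h q (mem_QM_cone.2 (posSemidef_vecMulVec_self_star v))
  have : star v ⬝ᵥ (b : Matrix (Fin n) (Fin n) ℂ) *ᵥ v = ((pairing n b q : ℝ) : ℂ) := by
    rw [ofReal_pairing, mul_vecMulVec, trace_vecMulVec, dotProduct_comm]
  rw [this]
  exact_mod_cast hq

end Pairing

/-! ### Isometric embeddings and compressions between matrix algebras. -/

section Conjugation

variable {n m : ℕ}

/-- The map `a ↦ V a V*` between Hermitian matrices. -/
def conjBy (V : Matrix (Fin m) (Fin n) ℂ) : Herm n →ₗ[ℝ] Herm m where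
  toFun a := ⟨V * (a : Matrix (Fin n) (Fin n) ℂ) * Vᴴ, isHermitian_mul_mul_conjTranspose V a.2⟩
  map_add' a b := Subtype.ext (by simp [Matrix.mul_add, Matrix.add_mul])
  map_smul' r a := Subtype.ext (by simp)

theorem conjBy_coe (V : Matrix (Fin m) (Fin n) ℂ) (a : Herm n) :
    (conjBy V a : Matrix (Fin m) (Fin m) ℂ) = V * (a : Matrix (Fin n) (Fin n) ℂ) * Vᴴ := rfl

theorem conjBy_mem_cone (V : Matrix (Fin m) (Fin n) ℂ) {a : Herm n} (ha : a ∈ (QM n).cone) :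
    conjBy V a ∈ (QM m).cone :=
  (mem_QM_cone.1 ha).mul_mul_conjTranspose_same V

theorem conjBy_conjTranspose_conjBy {V : Matrix (Fin m) (Fin n) ℂ} (hV : Vᴴ * V = 1)
    (a : Herm n) : conjBy Vᴴ (conjBy V a) = a := by
  refine Subtype.ext ?_
  rw [conjBy_coe, conjBy_coe, conjTranspose_conjTranspose]
  calc Vᴴ * (V * (a : Matrix (Fin n) (Fin n) ℂ) * Vᴴ) * V
      = (Vᴴ * V) * (a : Matrix (Fin n) (Fin n) ℂ) * (Vᴴ * V) := by simp only [Matrix.mul_assoc]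
    _ = (a : Matrix (Fin n) (Fin n) ℂ) := by rw [hV, one_mul, mul_one]

theorem QM_unit_conjBy {V : Matrix (Fin m) (Fin n) ℂ} (hV : Vᴴ * V = 1) (a : Herm n) :
    (QM m).unit (conjBy V a) = (QM n).unit a := by
  rw [QM_unit_apply, QM_unit_apply, conjBy_coe, trace_mul_comm, ← Matrix.mul_assoc, hV,
    one_mul]

theorem one_sub_mem_QM_cone {P : Herm n}
    (hP : (P : Matrix (Fin n) (Fin n) ℂ) * P = P) : 1 - P ∈ (QM n).cone := by
  have h : (((1 - P : Herm n)) : Matrix (Fin n) (Fin n) ℂ)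
      = (1 - (P : Matrix (Fin n) (Fin n) ℂ))ᴴ * (1 - (P : Matrix (Fin n) (Fin n) ℂ)) := by
    rw [conjTranspose_sub, conjTranspose_one, P.conjTranspose_coe, sub_mul, mul_sub, mul_sub, hP]
    simp
  rw [mem_QM_cone, h]
  exact posSemidef_conjTranspose_mul_self _

/-- `V V*` is a projection, hence at most `1`, and the left side is its pairing with `a`. -/
theorem QM_unit_conjBy_conjTranspose_le {V : Matrix (Fin m) (Fin n) ℂ} (hV : Vᴴ * V = 1)
    {a : Herm m} (ha : a ∈ (QM m).cone) :
    (QM n).unit (conjBy Vᴴ a) ≤ (QM m).unit a := by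
  have hP : 1 - conjBy V 1 ∈ (QM m).cone := by
    refine one_sub_mem_QM_cone ?_
    rw [conjBy_coe]
    calc V * ((1 : Herm n) : Matrix (Fin n) (Fin n) ℂ) * Vᴴ
          * (V * ((1 : Herm n) : Matrix (Fin n) (Fin n) ℂ) * Vᴴ)
        = V * (Vᴴ * V) * Vᴴ := by simp [Matrix.mul_assoc]
      _ = V * ((1 : Herm n) : Matrix (Fin n) (Fin n) ℂ) * Vᴴ := by rw [hV]; simp
  have h := pairing_nonneg hP ha
  have h2 : pairing m (conjBy V 1) a = (QM n).unit (conjBy Vᴴ a) := by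
    rw [pairing_apply, QM_unit_apply, conjBy_coe, conjBy_coe, conjTranspose_conjTranspose,
      Matrix.mul_assoc Vᴴ, trace_mul_comm Vᴴ, Matrix.mul_assoc _ V, trace_mul_comm]
    simp
  rw [map_sub, LinearMap.sub_apply, pairing_one_left, h2] at h
  linarith

theorem exists_isometry (h : n ≤ m) : ∃ V : Matrix (Fin m) (Fin n) ℂ, Vᴴ * V = 1 := by
  refine ⟨(1 : Matrix (Fin m) (Fin m) ℂ).submatrix id (Fin.castLE h), ?_⟩
  rw [conjTranspose_submatrix, conjTranspose_one, ← submatrix_mul _ _ _ _ _ Function.bijective_id,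
    one_mul, submatrix_one _ (Fin.castLE_injective h)]

end Conjugation

/-! ### An explicit weighted projective 2-design. -/

section Design

variable {n : ℕ}

/-- The power `i ^ a` of the imaginary unit. -/
def quarterPhase (a : ZMod 4) : ℂ := Complex.I ^ a.val

theorem quarterPhase_add_one (a : ZMod 4) :
    quarterPhase (a + 1) = Complex.I * quarterPhase a := by
  rw [quarterPhase, quarterPhase, ← pow_succ', ZMod.val_add, ZMod.val_one'' (by norm_num),
    ← Complex.I_pow_eq_pow_mod]

theorem quarterPhase_mul_star (a : ZMod 4) : quarterPhase a * star (quarterPhase a) = 1 := by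
  rw [quarterPhase, star_pow, ← mul_pow]
  simp

theorem quarterPhase_update {ε : Fin n → ZMod 4} (k i : Fin n) :
    quarterPhase ((ε + Pi.single k (1 : ZMod 4) : Fin n → ZMod 4) i)
      = (if i = k then Complex.I else 1) * quarterPhase (ε i) := by
  by_cases h : i = k
  · subst h; simp [quarterPhase_add_one]
  · simp [h]

/-- Fourth moments of independent uniform fourth roots of unity: only index patterns in which every
phase meets its own conjugate survive. -/
theorem sum_quarterPhase (i j k l : Fin n) :
    ∑ ε : Fin n → ZMod 4, quarterPhase (ε i) * star (quarterPhase (ε j)) *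
        (quarterPhase (ε k) * star (quarterPhase (ε l)))
      = if (i = j ∧ k = l) ∨ (i = l ∧ k = j) then (4 : ℂ) ^ n else 0 := by
  -- Translating `ε` by one at coordinate `s` permutes the summands and multiplies each by `c`; if
  -- `c ≠ 1` the sum vanishes.
  have shift : ∀ (s : Fin n) (c : ℂ), c ≠ 1 →
      (if i = s then Complex.I else 1) * star (if j = s then Complex.I else 1) *
        ((if k = s then Complex.I else 1) * star (if l = s then Complex.I else 1)) = c →
      ∑ ε : Fin n → ZMod 4, quarterPhase (ε i) * star (quarterPhase (ε j)) *
        (quarterPhase (ε k) * star (quarterPhase (ε l))) = 0 := by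
    intro s c hc h
    have h1 := Equiv.sum_comp (Equiv.addRight (Pi.single s (1 : ZMod 4)))
      (fun ε : Fin n → ZMod 4 => quarterPhase (ε i) * star (quarterPhase (ε j)) *
        (quarterPhase (ε k) * star (quarterPhase (ε l))))
    simp only [Equiv.coe_addRight, quarterPhase_update] at h1
    have h2 : c * ∑ ε : Fin n → ZMod 4, quarterPhase (ε i) * star (quarterPhase (ε j)) *
        (quarterPhase (ε k) * star (quarterPhase (ε l)))
        = ∑ ε : Fin n → ZMod 4, quarterPhase (ε i) * star (quarterPhase (ε j)) *
        (quarterPhase (ε k) * star (quarterPhase (ε l))) := by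
      refine Eq.trans ?_ h1
      rw [Finset.mul_sum]
      refine Finset.sum_congr rfl fun ε _ => ?_
      rw [← h, star_mul', star_mul']
      ring
    have h3 : (c - 1) * ∑ ε : Fin n → ZMod 4, quarterPhase (ε i) * star (quarterPhase (ε j)) *
        (quarterPhase (ε k) * star (quarterPhase (ε l))) = 0 := by
      rw [sub_mul, h2, one_mul, sub_self]
    exact (mul_eq_zero.1 h3).resolve_left (sub_ne_zero.2 hc)
  have hI : Complex.I ≠ 1 := fun h => by simpa using congrArg Complex.re h
  -- Here fourth roots are needed: with signs `±1` the repeated index `k = i` would give the factor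
  -- `1`.
  have hI2 : Complex.I * Complex.I ≠ 1 := fun h => by
    have := congrArg Complex.re h
    norm_num at this
  by_cases hij : i = j
  · subst hij
    by_cases hkl : k = l
    · subst hkl
      simp only [quarterPhase_mul_star]
      simp [ZMod.card]
    · have : ¬((i = i ∧ k = l) ∨ (i = l ∧ k = i)) := by
        rintro (⟨-, h⟩ | ⟨h, h'⟩)
        · exact hkl h
        · exact hkl (h'.trans h)
      rw [if_neg this]
      refine shift k Complex.I hI ?_
      by_cases hik : i = k <;> simp [hik, Ne.symm hkl]
  · by_cases hil : i = l
    · subst hil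
      by_cases hkj : k = j
      · subst hkj
        have : ∀ ε : Fin n → ZMod 4, quarterPhase (ε i) * star (quarterPhase (ε k)) *
            (quarterPhase (ε k) * star (quarterPhase (ε i))) = 1 := fun ε => by
          linear_combination (quarterPhase (ε k) * star (quarterPhase (ε k))) *
            quarterPhase_mul_star (ε i) + quarterPhase_mul_star (ε k)
        simp only [this]
        simp [ZMod.card]
      · have : ¬((i = j ∧ k = i) ∨ (i = i ∧ k = j)) := by tauto
        rw [if_neg this]
        refine shift k Complex.I hI ?_
        by_cases hik : i = k <;> simp [hik, Ne.symm hkj]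
    · have : ¬((i = j ∧ k = l) ∨ (i = l ∧ k = j)) := by tauto
      rw [if_neg this]
      by_cases hki : k = i
      · exact shift i (Complex.I * Complex.I) hI2 (by simp [hki, Ne.symm hij, Ne.symm hil])
      · exact shift i Complex.I hI (by simp [hki, Ne.symm hij, Ne.symm hil])

/-- The orthogonal projection onto the line of a unit vector. -/
def rankOne (v : Fin n → ℂ) : Herm n :=
  ⟨vecMulVec v (star v), (posSemidef_vecMulVec_self_star v).1⟩

theorem rankOne_coe (v : Fin n → ℂ) :
    (rankOne v : Matrix (Fin n) (Fin n) ℂ) = vecMulVec v (star v) := rfl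

/-- A weighted complex projective `2`-design: finitely many one-dimensional projections `P k` and
weights `w k ≥ 0` with `∑ k, w k ⟨P k, a⟩ P k = Tr(a) 1 + a`. -/
structure IsDesign {K : Type} [Fintype K] (P : K → Herm n) (w : K → ℝ) : Prop where
  mul_self : ∀ k, (P k : Matrix (Fin n) (Fin n) ℂ) * P k = P k
  unit : ∀ k, (QM n).unit (P k) = 1
  nonneg : ∀ k, 0 ≤ w k
  sum_eq : ∀ a, ∑ k, (w k * pairing n (P k) a) • P k = (QM n).unit a • (1 : Herm n) + a

theorem rankOne_mul_self {v : Fin n → ℂ} (hv : star v ⬝ᵥ v = 1) :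
    (rankOne v : Matrix (Fin n) (Fin n) ℂ) * rankOne v = rankOne v := by
  rw [rankOne_coe, vecMulVec_mul_vecMulVec, hv, one_smul]

theorem QM_unit_rankOne {v : Fin n → ℂ} (hv : star v ⬝ᵥ v = 1) :
    (QM n).unit (rankOne v) = 1 := by
  rw [QM_unit_apply, rankOne_coe, trace_vecMulVec, dotProduct_comm, hv, Complex.one_re]

theorem ofReal_pairing_rankOne (v : Fin n → ℂ) (a : Herm n) :
    ((pairing n (rankOne v) a : ℝ) : ℂ)
      = ∑ i, ∑ j, v i * star (v j) * (a : Matrix (Fin n) (Fin n) ℂ) j i := by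
  rw [ofReal_pairing, rankOne_coe, trace]
  simp only [diag_apply, mul_apply, vecMulVec_apply, Pi.star_apply]

/-- The vectors of the design: the standard basis and the vectors all of whose coordinates are
fourth roots of unity, divided by `√n`. -/
def designVector (n : ℕ) : Fin n ⊕ (Fin n → ZMod 4) → Fin n → ℂ
  | .inl i => Pi.single i 1
  | .inr ε => fun i => ((√n)⁻¹ : ℝ) * quarterPhase (ε i)

theorem star_designVector_dotProduct (hn : 1 ≤ n) (k : Fin n ⊕ (Fin n → ZMod 4)) :
    star (designVector n k) ⬝ᵥ designVector n k = 1 := by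
  have hn' : (n : ℝ) ≠ 0 := by positivity
  rcases k with i | ε
  · simp [designVector]
  · have h : ∀ i, star (designVector n (.inr ε)) i * designVector n (.inr ε) i
        = (((n : ℝ)⁻¹ : ℝ) : ℂ) := fun i => by
      have h1 : ((√n)⁻¹ : ℝ) * ((√n)⁻¹ : ℝ) = (n : ℝ)⁻¹ := by
        rw [← mul_inv, Real.mul_self_sqrt (by positivity)]
      have h2 : (((√n)⁻¹ : ℝ) : ℂ) * (((√n)⁻¹ : ℝ) : ℂ) = (((n : ℝ)⁻¹ : ℝ) : ℂ) := by
        exact_mod_cast h1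
      simp only [designVector, Pi.star_apply, star_mul', Complex.star_def, Complex.conj_ofReal]
      have h3 := quarterPhase_mul_star (ε i)
      rw [Complex.star_def] at h3
      linear_combination ((((√n)⁻¹ : ℝ) : ℂ) * (((√n)⁻¹ : ℝ) : ℂ)) * h3 + h2
    rw [dotProduct, Finset.sum_congr rfl fun i _ => h i]
    simp
    field_simp

/-- The phase vectors contribute `Tr(a) 1` plus the off-diagonal part of `a`; the standard basis
supplies the missing diagonal part. -/
theorem exists_isDesign (hn : 1 ≤ n) :
    ∃ (K : Type) (_ : Fintype K) (P : K → Herm n) (w : K → ℝ), IsDesign P w := by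
  have hn' : (n : ℂ) ≠ 0 := by
    have : n ≠ 0 := by omega
    exact_mod_cast this
  refine ⟨Fin n ⊕ (Fin n → ZMod 4), inferInstance, fun k => rankOne (designVector n k),
    -- The factor `n ^ 2` cancels the four factors `1/√n` of the phase vectors, and `4 ^ n` is their
    -- number.
    Sum.elim (fun _ => 1) (fun _ => (n : ℝ) ^ 2 / 4 ^ n),
    fun k => rankOne_mul_self (star_designVector_dotProduct hn k),
    fun k => QM_unit_rankOne (star_designVector_dotProduct hn k), ?_, fun a => ?_⟩
  · rintro (i | ε)
    · exact zero_le_one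
    · simp only [Sum.elim_inr]; positivity
  · refine Subtype.ext (Matrix.ext fun k l => ?_)
    have hl : (((∑ q : Fin n ⊕ (Fin n → ZMod 4), (Sum.elim (fun _ => 1)
          (fun _ => (n : ℝ) ^ 2 / 4 ^ n) q * pairing n (rankOne (designVector n q)) a) •
          rankOne (designVector n q) : Herm n)) : Matrix (Fin n) (Fin n) ℂ) k l
        = ∑ q : Fin n ⊕ (Fin n → ZMod 4), ((Sum.elim (fun _ => 1)
          (fun _ => (n : ℝ) ^ 2 / 4 ^ n) q : ℝ) : ℂ) *
          ((pairing n (rankOne (designVector n q)) a : ℝ) : ℂ) *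
          (designVector n q k * star (designVector n q l)) := by
      rw [AddSubgroup.val_finsetSum, Matrix.sum_apply]
      refine Finset.sum_congr rfl fun q _ => ?_
      simp [rankOne_coe, vecMulVec_apply, selfAdjoint.val_smul]
    rw [hl, Fintype.sum_sum_type]
    have h1 : ∑ i : Fin n, ((Sum.elim (fun _ => 1)
          (fun _ => (n : ℝ) ^ 2 / 4 ^ n) (Sum.inl i : Fin n ⊕ (Fin n → ZMod 4)) : ℝ) : ℂ) *
          ((pairing n (rankOne (designVector n (.inl i))) a : ℝ) : ℂ) *
          (designVector n (.inl i) k * star (designVector n (.inl i) l))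
        = if k = l then (a : Matrix (Fin n) (Fin n) ℂ) k l else 0 := by
      have h0 : ∀ i, ((pairing n (rankOne (Pi.single i 1)) a : ℝ) : ℂ)
          = (a : Matrix (Fin n) (Fin n) ℂ) i i := fun i => by
        rw [ofReal_pairing_rankOne, Finset.sum_eq_single i (by simp +contextual) (by simp),
          Finset.sum_eq_single i (by simp +contextual) (by simp)]
        simp
      simp only [designVector, Sum.elim_inl, h0]
      rw [Finset.sum_eq_single k (fun i _ hi => by simp [hi.symm]) (by simp)]
      by_cases h : k = l
      · simp [h]
      · simp [h, Ne.symm h]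
    have h2 : ∑ ε : Fin n → ZMod 4, ((Sum.elim (fun _ => 1)
          (fun _ => (n : ℝ) ^ 2 / 4 ^ n) (Sum.inr ε : Fin n ⊕ (Fin n → ZMod 4)) : ℝ) : ℂ) *
          ((pairing n (rankOne (designVector n (.inr ε))) a : ℝ) : ℂ) *
          (designVector n (.inr ε) k * star (designVector n (.inr ε) l))
        = ∑ i, ∑ j, (if (i = j ∧ k = l) ∨ (i = l ∧ k = j) then
            (a : Matrix (Fin n) (Fin n) ℂ) j i else 0) := by
      have h4 : ∀ ε : Fin n → ZMod 4, ((Sum.elim (fun _ => 1)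
          (fun _ => (n : ℝ) ^ 2 / 4 ^ n) (Sum.inr ε : Fin n ⊕ (Fin n → ZMod 4)) : ℝ) : ℂ) *
          ((pairing n (rankOne (designVector n (.inr ε))) a : ℝ) : ℂ) *
          (designVector n (.inr ε) k * star (designVector n (.inr ε) l))
          = ∑ i, ∑ j, ((4 : ℂ) ^ n)⁻¹ * (a : Matrix (Fin n) (Fin n) ℂ) j i *
            (quarterPhase (ε i) * star (quarterPhase (ε j)) *
              (quarterPhase (ε k) * star (quarterPhase (ε l)))) := by
        intro ε
        have h5 : (((√n)⁻¹ : ℝ) : ℂ) * (((√n)⁻¹ : ℝ) : ℂ) * n = 1 := by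
          have : ((√n)⁻¹ : ℝ) * ((√n)⁻¹ : ℝ) * n = 1 := by
            rw [← mul_inv, Real.mul_self_sqrt (by positivity), inv_mul_cancel₀]
            exact_mod_cast hn'
          exact_mod_cast this
        rw [ofReal_pairing_rankOne, Finset.mul_sum, Finset.sum_mul]
        refine Finset.sum_congr rfl fun i _ => ?_
        rw [Finset.mul_sum, Finset.sum_mul]
        refine Finset.sum_congr rfl fun j _ => ?_
        simp only [designVector, Sum.elim_inr, star_mul', Complex.star_def, Complex.conj_ofReal]
        generalize (((√n)⁻¹ : ℝ) : ℂ) = s at h5 ⊢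
        push_cast
        have h6 : (n : ℂ) ^ 2 * (s * s) ^ 2 = 1 := by
          linear_combination (s * s * n + 1) * h5
        field_simp
        linear_combination ((quarterPhase (ε i) * (starRingEnd ℂ) (quarterPhase (ε j)) *
          (a : Matrix (Fin n) (Fin n) ℂ) j i * (quarterPhase (ε k) *
          (starRingEnd ℂ) (quarterPhase (ε l))))) * h6
      rw [Finset.sum_congr rfl fun ε _ => h4 ε, Finset.sum_comm]
      refine Finset.sum_congr rfl fun i _ => ?_
      rw [Finset.sum_comm]
      refine Finset.sum_congr rfl fun j _ => ?_
      rw [← Finset.mul_sum, sum_quarterPhase]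
      split_ifs
      · field_simp
      · simp
    have h3 : (((QM n).unit a • (1 : Herm n) + a : Herm n) : Matrix (Fin n) (Fin n) ℂ) k l
        = (if k = l then (a : Matrix (Fin n) (Fin n) ℂ).trace else 0)
          + (a : Matrix (Fin n) (Fin n) ℂ) k l := by
      rw [← ofReal_QM_unit]
      by_cases h : k = l <;> simp [h, selfAdjoint.val_smul]
    rw [h1, h2, h3]
    by_cases h : k = l
    · subst h
      have : ∀ i j : Fin n, (i = j ∨ i = k ∧ k = j) ↔ i = j := fun i j =>
        or_iff_left_of_imp fun h => h.1.trans h.2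
      simp only [and_true, this]
      simp [trace, add_comm]
    · simp [h, ite_and]

namespace IsDesign

variable {K : Type} [Fintype K] {P : K → Herm n} {w : K → ℝ}

theorem sum_smul (h : IsDesign P w) : ∑ k, w k • P k = ((n : ℝ) + 1) • (1 : Herm n) := by
  have := h.sum_eq 1
  simp only [pairing_one_right, h.unit, mul_one, QM_unit_one] at this
  rw [this, add_smul, one_smul]

theorem sum_weight (h : IsDesign P w) : ∑ k, w k = n * ((n : ℝ) + 1) := by
  have := congrArg (QM n).unit h.sum_smul
  rw [map_sum] at this
  simp only [map_smul, h.unit, QM_unit_one, smul_eq_mul, mul_one] at this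
  rw [this, mul_comm]

end IsDesign

end Design

/-! ### Convex hulls of cones, effects and two-outcome measurements. -/

section Cones

variable {V : Type} [AddCommGroup V] [Module ℝ V]

theorem smul_mem_convexHull {S : Set V} (hS : ∀ c : ℝ, 0 ≤ c → ∀ x ∈ S, c • x ∈ S) {c : ℝ}
    (hc : 0 ≤ c) {x : V} (hx : x ∈ convexHull ℝ S) : c • x ∈ convexHull ℝ S :=
  convexHull_min (fun y hy =>
      show c • y ∈ convexHull ℝ S from subset_convexHull ℝ S (hS c hc y hy))
    ((convex_convexHull ℝ S).smul_preimage c) hx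

theorem add_mem_convexHull {S : Set V} (hS : ∀ c : ℝ, 0 ≤ c → ∀ x ∈ S, c • x ∈ S) {x y : V}
    (hx : x ∈ convexHull ℝ S) (hy : y ∈ convexHull ℝ S) : x + y ∈ convexHull ℝ S := by
  have h := convex_convexHull ℝ S (smul_mem_convexHull hS zero_le_two hx)
    (smul_mem_convexHull hS zero_le_two hy) (a := 1 / 2) (b := 1 / 2) (by norm_num) (by norm_num)
    (by norm_num)
  simpa [smul_smul] using h

theorem sum_mem_convexHull {S : Set V} (hS : ∀ c : ℝ, 0 ≤ c → ∀ x ∈ S, c • x ∈ S)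
    (h0 : (0 : V) ∈ S) {ι : Type} {s : Finset ι} {x : ι → V}
    (hx : ∀ i ∈ s, x i ∈ convexHull ℝ S) : ∑ i ∈ s, x i ∈ convexHull ℝ S :=
  Finset.sum_induction x (· ∈ convexHull ℝ S) (fun _ _ => add_mem_convexHull hS)
    (subset_convexHull ℝ S h0) hx

theorem zero_mem_dualCone (K : Set V) : (0 : Module.Dual ℝ V) ∈ dualCone K := fun _ _ => le_rfl

theorem smul_mem_dualCone {K : Set V} {c : ℝ} (hc : 0 ≤ c) {f : Module.Dual ℝ V}
    (hf : f ∈ dualCone K) : c • f ∈ dualCone K := fun a ha => mul_nonneg hc (hf a ha)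

/-- The two-outcome family `(e, u - e)`. -/
def binary (u e : Module.Dual ℝ V) : FinFamily V :=
  { ι := Bool, effect := fun b => cond b e (u - e) }

theorem sum_binary {N : Type} [AddCommMonoid N] (u e : Module.Dual ℝ V)
    (φ : Module.Dual ℝ V → N) :
    ∑ i, φ ((binary u e).effect i) = φ e + φ (u - e) :=
  Fintype.sum_bool _

variable {G : GPTData V}

theorem isMeasurement_of_mem_dualCone {I : Type} [Fintype I] {e : I → Module.Dual ℝ V}
    (he : ∀ i, e i ∈ dualCone G.cone) (hsum : ∑ i, e i = G.unit) : G.IsMeasurement e := by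
  refine ⟨fun i => ⟨he i, fun a ha => ?_⟩, hsum⟩
  rw [← hsum, LinearMap.sub_apply, LinearMap.sum_apply, sub_nonneg]
  exact Finset.single_le_sum (f := fun j => e j a) (fun j _ => he j a ha) (Finset.mem_univ i)

theorem sub_mem_effects {e : Module.Dual ℝ V} (he : e ∈ G.effects) : G.unit - e ∈ G.effects :=
  ⟨he.2, by rw [sub_sub_cancel]; exact he.1⟩

theorem zero_mem_effects {e : Module.Dual ℝ V} (he : e ∈ G.effects) : 0 ∈ G.effects := by
  refine ⟨zero_mem_dualCone _, fun a ha => ?_⟩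
  have h1 := he.1 a ha
  have h2 := he.2 a ha
  simp only [LinearMap.sub_apply, LinearMap.zero_apply] at *
  linarith

theorem isMeasurement_binary {e : Module.Dual ℝ V} (he : e ∈ G.effects) :
    G.IsMeasurement (fun b : Bool => cond b e (G.unit - e)) := by
  refine ⟨fun b => ?_, ?_⟩
  · cases b
    · exact sub_mem_effects he
    · exact he
  · simp

theorem sum_mem_effects {I : Type} [Fintype I] {e : I → Module.Dual ℝ V}
    (he : G.IsMeasurement e) (s : Finset I) : ∑ i ∈ s, e i ∈ G.effects := by
  classical
  refine ⟨fun a ha => ?_, fun a ha => ?_⟩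
  · rw [LinearMap.sum_apply]
    exact Finset.sum_nonneg fun i _ => (he.1 i).1 a ha
  · rw [← he.2, ← Finset.sum_add_sum_compl s e, add_sub_cancel_left, LinearMap.sum_apply]
    exact Finset.sum_nonneg fun i _ => (he.1 i).1 a ha

end Cones

/-! ### Reduction of the data hiding ratio to a noise bound and one pair of states. -/

section DataHiding

variable {V : Type} [AddCommGroup V] [Module ℝ V] {G : GPTData V}

/-- Each term is at most `p e(ρ) + (1-p) e(σ)`, and these sum to `1`. The bound makes the supremum
in `distNorm` genuine. -/
theorem sum_abs_le_one {ρ σ : V} (hρ : ρ ∈ G.states) (hσ : σ ∈ G.states) {p : ℝ}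
    (hp : p ∈ Set.Icc (0 : ℝ) 1) {I : Type} [Fintype I] {e : I → Module.Dual ℝ V}
    (he : G.IsMeasurement e) : ∑ i, |e i (p • ρ - (1 - p) • σ)| ≤ 1 := by
  have hsum : ∀ x, ∑ i, e i x = G.unit x := fun x => by rw [← he.2, LinearMap.sum_apply]
  calc ∑ i, |e i (p • ρ - (1 - p) • σ)| ≤ ∑ i, (p * e i ρ + (1 - p) * e i σ) := by
        refine Finset.sum_le_sum fun i _ => ?_
        have h1 := mul_nonneg hp.1 ((he.1 i).1 ρ hρ.1)
        have h2 := mul_nonneg (sub_nonneg.2 hp.2) ((he.1 i).1 σ hσ.1)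
        rw [map_sub, map_smul, map_smul, smul_eq_mul, smul_eq_mul, abs_le]
        constructor <;> linarith
    _ = 1 := by
        rw [Finset.sum_add_distrib, ← Finset.mul_sum, ← Finset.mul_sum, hsum, hsum, hρ.2, hσ.2]
        ring

theorem bddAbove_distNorm {M : Set (FinFamily V)} (hM : M ⊆ G.measurements) {ρ σ : V}
    (hρ : ρ ∈ G.states) (hσ : σ ∈ G.states) {p : ℝ} (hp : p ∈ Set.Icc (0 : ℝ) 1) :
    BddAbove {r : ℝ | ∃ F ∈ M, r = ∑ i, |F.effect i (p • ρ - (1 - p) • σ)|} := by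
  refine ⟨1, ?_⟩
  rintro r ⟨F, hF, rfl⟩
  exact sum_abs_le_one hρ hσ hp (hM hF)

theorem distNorm_nonneg (M : Set (FinFamily V)) (x : V) : 0 ≤ distNorm M x := by
  refine Real.sSup_nonneg ?_
  rintro r ⟨F, -, rfl⟩
  exact Finset.sum_nonneg fun i _ => abs_nonneg _

/-- The outcomes of any measurement on which `x` is positive can be merged into one effect. -/
theorem exists_effect_sum_abs_eq {F : FinFamily V} (hF : F ∈ G.measurements) (x : V) :
    ∃ e ∈ G.effects, ∑ i, |F.effect i x| = 2 * e x - G.unit x := by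
  classical
  refine ⟨∑ i ∈ Finset.univ.filter (fun i => 0 ≤ F.effect i x), F.effect i,
    sum_mem_effects hF _, ?_⟩
  rw [← show ∑ i, F.effect i = G.unit from hF.2, LinearMap.sum_apply, LinearMap.sum_apply,
    Finset.sum_filter, Finset.mul_sum, ← Finset.sum_sub_distrib]
  refine Finset.sum_congr rfl fun i _ => ?_
  split_ifs with h
  · rw [abs_of_nonneg h]; ring
  · rw [abs_of_neg (not_le.1 h)]; ring

/-- If every effect `e` can be realised by `M` after mixing it with noise, then `M` distinguishes
almost as well as all measurements. -/
theorem distNorm_measurements_le {M : Set (FinFamily V)} (hM : M ⊆ G.measurements) {m : ℝ}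
    (hm : 1 ≤ m)
    (hup : ∀ e ∈ G.effects,
      binary G.unit ((2 * m - 1)⁻¹ • ((m - 1) • G.unit + e)) ∈ M)
    {ρ σ : V} (hρ : ρ ∈ G.states) (hσ : σ ∈ G.states) {p : ℝ} (hp : p ∈ Set.Icc (0 : ℝ) 1) :
    distNorm G.measurements (p • ρ - (1 - p) • σ)
      ≤ (2 * m - 1) * distNorm M (p • ρ - (1 - p) • σ) := by
  have hR : 0 < 2 * m - 1 := by linarith
  refine Real.sSup_le ?_ (mul_nonneg hR.le (distNorm_nonneg _ _))
  rintro r ⟨F, hF, rfl⟩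
  obtain ⟨e, he, hs⟩ := exists_effect_sum_abs_eq hF (p • ρ - (1 - p) • σ)
  rw [hs]
  have h1 := le_csSup (bddAbove_distNorm hM hρ hσ hp) ⟨_, hup e he, rfl⟩
  rw [sum_binary G.unit _ (fun f => |f (p • ρ - (1 - p) • σ)|)] at h1
  change _ ≤ distNorm M _ at h1
  generalize p • ρ - (1 - p) • σ = x at *
  -- For the noisy effect `e'`, the unit cancels to leave `2e' - u = (2m-1)⁻¹ (2e - u)`.
  have h2 : (2 * m - 1)⁻¹ * (2 * e x - G.unit x) ≤ distNorm M x := by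
    refine le_trans ?_ h1
    have h3 := le_abs_self (((2 * m - 1)⁻¹ • ((m - 1) • G.unit + e)) x)
    have h4 := neg_le_abs ((G.unit - (2 * m - 1)⁻¹ • ((m - 1) • G.unit + e)) x)
    refine le_trans (le_of_eq ?_) (add_le_add h3 h4)
    simp only [LinearMap.smul_apply, LinearMap.sub_apply, LinearMap.add_apply, smul_eq_mul]
    field_simp
    ring
  rwa [inv_mul_le_iff₀ hR] at h2

/-- If `x = pρ - (1-p)σ` is nonnegative on the effects occurring in `M`, the absolute values drop
out and every measurement of `M` gives exactly `u(x)`. So `hdisc` gives zero error for all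
measurements, `hunit` and `hpos` give efficiency `2m-1`, and `hup` shows that none is higher. -/
theorem isDataHidingRatio_of {M : Set (FinFamily V)} (hM : M ⊆ G.measurements)
    (hic : IsInformationallyComplete M) {m : ℝ} (hm : 1 ≤ m)
    (hup : ∀ e ∈ G.effects, binary G.unit ((2 * m - 1)⁻¹ • ((m - 1) • G.unit + e)) ∈ M)
    {ρ σ : V} (hρ : ρ ∈ G.states) (hσ : σ ∈ G.states) {p : ℝ} (hp : p ∈ Set.Icc (0 : ℝ) 1)
    {e : Module.Dual ℝ V} (he : e ∈ G.effects)
    (hdisc : 2 * e (p • ρ - (1 - p) • σ) - G.unit (p • ρ - (1 - p) • σ) = 1)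
    (hunit : G.unit (p • ρ - (1 - p) • σ) = 1 / (2 * m - 1))
    (hpos : ∀ F ∈ M, ∀ i, 0 ≤ F.effect i (p • ρ - (1 - p) • σ)) :
    G.IsDataHidingRatio M (2 * m - 1) := by
  have hR : 0 < 2 * m - 1 := by linarith
  refine ⟨hM, hic, ⟨by linarith, ρ, hρ, σ, hσ, p, hp, ?_, ?_⟩, ?_⟩
  · have h1 : distNorm G.measurements (p • ρ - (1 - p) • σ) = 1 := by
      refine le_antisymm (Real.sSup_le ?_ zero_le_one) ?_
      · rintro r ⟨F, hF, rfl⟩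
        exact sum_abs_le_one hρ hσ hp hF
      · refine le_trans ?_ (le_csSup (bddAbove_distNorm subset_rfl hρ hσ hp)
          ⟨binary G.unit e, isMeasurement_binary he, rfl⟩)
        rw [sum_binary G.unit e (fun f => |f (p • ρ - (1 - p) • σ)|)]
        have h3 := le_abs_self (e (p • ρ - (1 - p) • σ))
        have h4 := neg_le_abs ((G.unit - e) (p • ρ - (1 - p) • σ))
        rw [LinearMap.sub_apply] at h4 ⊢
        linarith
    rw [errorProb, h1]
    norm_num
  · have h1 : ∀ F ∈ M, ∑ i, |F.effect i (p • ρ - (1 - p) • σ)| = 1 / (2 * m - 1) := by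
      intro F hF
      rw [← hunit, ← (show ∑ i, F.effect i = G.unit from (hM hF).2), LinearMap.sum_apply]
      exact Finset.sum_congr rfl fun i _ => abs_of_nonneg (hpos F hF i)
    have h2 : {r : ℝ | ∃ F ∈ M, r = ∑ i, |F.effect i (p • ρ - (1 - p) • σ)|}
        = {1 / (2 * m - 1)} := by
      ext r
      constructor
      · rintro ⟨F, hF, rfl⟩
        exact h1 F hF
      · rintro rfl
        exact ⟨_, hup e he, (h1 _ (hup e he)).symm⟩
    rw [errorProb, distNorm, h2, csSup_singleton]
  · rintro r ⟨hr, ρ', hρ', σ', hσ', q, hq, h1, h2⟩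
    have h3 := distNorm_measurements_le hM hm hup hρ' hσ' hq
    have h4 : distNorm G.measurements (q • ρ' - (1 - q) • σ') = 1 := by
      rw [errorProb] at h1; linarith
    have h5 : distNorm M (q • ρ' - (1 - q) • σ') = 1 / r := by
      rw [errorProb] at h2; linarith
    rw [h4, h5, mul_one_div, le_div_iff₀ (by linarith)] at h3
    linarith

end DataHiding

/-! ### Separable and one-way LOCC measurements on minimal composites. -/

section Bipartite

variable {V W : Type} [AddCommGroup V] [Module ℝ V] [AddCommGroup W] [Module ℝ W]
  {A : GPTData V} {B : GPTData W}

@[simp]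
theorem prodFunctional_tmul (e : Module.Dual ℝ V) (f : Module.Dual ℝ W) (a : V) (b : W) :
    prodFunctional e f (a ⊗ₜ b) = e a * f b := by
  rw [prodFunctional, TensorProduct.dualDistrib_apply]

theorem prodFunctional_smul_left (c : ℝ) (e : Module.Dual ℝ V) (f : Module.Dual ℝ W) :
    prodFunctional (c • e) f = c • prodFunctional e f :=
  TensorProduct.ext' fun a b => by simp [mul_assoc]

theorem minTensor_unit_tmul (a : V) (b : W) :
    (A.minTensor B).unit (a ⊗ₜ b) = A.unit a * B.unit b :=
  prodFunctional_tmul _ _ _ _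

theorem mem_dualCone_minTensor {f : Module.Dual ℝ (V ⊗[ℝ] W)} :
    f ∈ dualCone (A.minTensor B).cone ↔ ∀ a ∈ A.cone, ∀ b ∈ B.cone, 0 ≤ f (a ⊗ₜ b) := by
  constructor
  · exact fun h a ha b hb => h _ (subset_convexHull ℝ _ ⟨a, ha, b, hb, rfl⟩)
  · intro h z hz
    refine convexHull_min (t := {z | 0 ≤ f z}) ?_ (convex_halfSpace_ge f.isLinear 0) hz
    rintro _ ⟨a, ha, b, hb, rfl⟩
    exact h a ha b hb

theorem prodFunctional_mem_separableEffectCone {e : Module.Dual ℝ V} {f : Module.Dual ℝ W}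
    (he : e ∈ dualCone A.cone) (hf : f ∈ dualCone B.cone) :
    prodFunctional e f ∈ separableEffectCone A B :=
  subset_convexHull ℝ _ ⟨e, he, f, hf, rfl⟩

theorem sum_mem_separableEffectCone {ι : Type} {s : Finset ι}
    {g : ι → Module.Dual ℝ (V ⊗[ℝ] W)} (hg : ∀ i ∈ s, g i ∈ separableEffectCone A B) :
    ∑ i ∈ s, g i ∈ separableEffectCone A B := by
  refine sum_mem_convexHull ?_ ?_ hg
  · rintro c hc _ ⟨e, he, f, hf, rfl⟩
    exact ⟨c • e, smul_mem_dualCone hc he, f, hf, (prodFunctional_smul_left c e f).symm⟩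
  · exact ⟨0, zero_mem_dualCone _, 0, zero_mem_dualCone _, by simp [prodFunctional]⟩

theorem separableEffectCone_subset : separableEffectCone A B ⊆ dualCone (A.minTensor B).cone := by
  intro g hg
  rw [mem_dualCone_minTensor]
  intro a ha b hb
  refine convexHull_min (t := {g : Module.Dual ℝ (V ⊗[ℝ] W) | 0 ≤ g (a ⊗ₜ b)}) ?_
    (convex_halfSpace_ge (LinearMap.applyₗ (a ⊗ₜ[ℝ] b)).isLinear 0) hg
  rintro _ ⟨e, he, f, hf, rfl⟩
  rw [Set.mem_ofPred_eq, prodFunctional_tmul]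
  exact mul_nonneg (he a ha) (hf b hb)

theorem mem_SEP_of_sum_eq {F : FinFamily (V ⊗[ℝ] W)}
    (hF : ∀ i, F.effect i ∈ separableEffectCone A B)
    (hsum : ∑ i, F.effect i = (A.minTensor B).unit) : F ∈ SEP A B :=
  ⟨isMeasurement_of_mem_dualCone (fun i => separableEffectCone_subset (hF i)) hsum, hF⟩

theorem coarseGraining_subset_SEP {M : Set (FinFamily (V ⊗[ℝ] W))} (hM : M ⊆ SEP A B) :
    coarseGraining M ⊆ SEP A B := by
  classical
  rintro F ⟨F', hF', π, hπ⟩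
  refine mem_SEP_of_sum_eq (fun j => ?_) ?_
  · rw [hπ]
    exact sum_mem_separableEffectCone fun i _ => (hM hF').2 i
  · rw [Finset.sum_congr rfl fun j _ => hπ j, ← (show _ = _ from (hM hF').1.2)]
    convert Finset.sum_fiberwise Finset.univ π F'.effect

theorem LOCCAtoB_subset_SEP : LOCCAtoB A B ⊆ SEP A B := by
  refine coarseGraining_subset_SEP ?_
  rintro _ ⟨I, J, _, _, e, f, he, hf, rfl⟩
  refine mem_SEP_of_sum_eq (fun q => prodFunctional_mem_separableEffectCone (he.1 _).1
    ((hf _).1 _).1) (TensorProduct.ext' fun a b => ?_)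
  have hu : A.unit a = ∑ i, e i a := by rw [← he.2, LinearMap.sum_apply]
  rw [minTensor_unit_tmul, hu, Finset.sum_mul, LinearMap.sum_apply]
  refine (Fintype.sum_prod_type _).trans (Finset.sum_congr rfl fun i _ => ?_)
  rw [← (hf i).2, LinearMap.sum_apply, Finset.mul_sum]
  exact Finset.sum_congr rfl fun j _ => prodFunctional_tmul _ _ _ _

theorem LOCCBtoA_subset_SEP : LOCCBtoA A B ⊆ SEP A B := by
  refine coarseGraining_subset_SEP ?_
  rintro _ ⟨I, J, _, _, e, f, he, hf, rfl⟩
  refine mem_SEP_of_sum_eq (fun q => prodFunctional_mem_separableEffectCone ((he _).1 _).1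
    (hf.1 _).1) (TensorProduct.ext' fun a b => ?_)
  have hu : B.unit b = ∑ j, f j b := by rw [← hf.2, LinearMap.sum_apply]
  rw [minTensor_unit_tmul, hu, Finset.mul_sum, LinearMap.sum_apply]
  refine (Fintype.sum_prod_type_right _).trans (Finset.sum_congr rfl fun j _ => ?_)
  rw [← (he j).2, LinearMap.sum_apply, Finset.sum_mul]
  exact Finset.sum_congr rfl fun i _ => prodFunctional_tmul _ _ _ _

/-- On receiving `i`, the second party measures `f i` against `B.unit - f i`; the coarse graining
then forgets `i`. -/
theorem binary_mem_LOCCAtoB {I : Type} [Fintype I] {e : I → Module.Dual ℝ V}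
    {f : I → Module.Dual ℝ W} (he : A.IsMeasurement e) (hf : ∀ i, f i ∈ B.effects) :
    binary (A.minTensor B).unit (∑ i, prodFunctional (e i) (f i)) ∈ LOCCAtoB A B := by
  classical
  refine ⟨_, ⟨I, Bool, inferInstance, inferInstance, e,
    fun i b => cond b (f i) (B.unit - f i), he, fun i => isMeasurement_binary (hf i), rfl⟩,
    Prod.snd, fun j => ?_⟩
  have h : ∀ (j : Bool) (φ : I × Bool → Module.Dual ℝ (V ⊗[ℝ] W)),
      ∑ q ∈ Finset.univ.filter (fun q : I × Bool => q.2 = j), φ q = ∑ i, φ (i, j) := by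
    intro j φ
    rw [Finset.sum_filter, Fintype.sum_prod_type]
    cases j <;> simp
  refine Eq.trans ?_ (Eq.trans (h _ _).symm (Finset.sum_congr (by ext; simp; exact Iff.rfl) fun _ _ => rfl))
  cases j
  · refine TensorProduct.ext' fun a b => ?_
    simp only [binary, cond_false, LinearMap.sub_apply, LinearMap.sum_apply, minTensor_unit_tmul,
      prodFunctional_tmul, mul_sub, Finset.sum_sub_distrib, ← he.2, Finset.sum_mul]
  · rfl

theorem binary_mem_LOCCBtoA {J : Type} [Fintype J] {e : J → Module.Dual ℝ V}
    {f : J → Module.Dual ℝ W} (he : ∀ j, e j ∈ A.effects) (hf : B.IsMeasurement f) :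
    binary (A.minTensor B).unit (∑ j, prodFunctional (e j) (f j)) ∈ LOCCBtoA A B := by
  classical
  refine ⟨_, ⟨Bool, J, inferInstance, inferInstance,
    fun j b => cond b (e j) (A.unit - e j), f, fun j => isMeasurement_binary (he j), hf, rfl⟩,
    Prod.fst, fun i => ?_⟩
  have h : ∀ (i : Bool) (φ : Bool × J → Module.Dual ℝ (V ⊗[ℝ] W)),
      ∑ q ∈ Finset.univ.filter (fun q : Bool × J => q.1 = i), φ q = ∑ j, φ (i, j) := by
    intro i φ
    rw [Finset.sum_filter, Fintype.sum_prod_type_right]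
    cases i <;> simp
  refine Eq.trans ?_ (Eq.trans (h _ _).symm (Finset.sum_congr (by ext; simp; exact Iff.rfl) fun _ _ => rfl))
  cases i
  · refine TensorProduct.ext' fun a b => ?_
    simp only [binary, cond_false, LinearMap.sub_apply, LinearMap.sum_apply, minTensor_unit_tmul,
      prodFunctional_tmul, sub_mul, Finset.sum_sub_distrib, ← hf.2, Finset.mul_sum]
  · rfl

theorem IsInformationallyComplete.mono {M N : Set (FinFamily V)} (h : M ⊆ N)
    (hM : IsInformationallyComplete M) : IsInformationallyComplete N := by
  refine top_le_iff.1 (hM.ge.trans (Submodule.span_mono ?_))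
  rintro g ⟨F, hF, i, rfl⟩
  exact ⟨F, h hF, i, rfl⟩

/-- In finite dimension `V* ⊗ W*` is all of `(V ⊗ W)*`, so products of spanning sets of effects
span. -/
theorem isInformationallyComplete_of_prodFunctional [FiniteDimensional ℝ V]
    [FiniteDimensional ℝ W] (hA : Submodule.span ℝ A.effects = ⊤)
    (hB : Submodule.span ℝ B.effects = ⊤) {u : Module.Dual ℝ (V ⊗[ℝ] W)}
    {M : Set (FinFamily (V ⊗[ℝ] W))}
    (hM : ∀ e ∈ A.effects, ∀ f ∈ B.effects, binary u (prodFunctional e f) ∈ M) :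
    IsInformationallyComplete M := by
  rw [IsInformationallyComplete, ← top_le_iff]
  have h1 : Submodule.map₂ (TensorProduct.mk ℝ (Module.Dual ℝ V) (Module.Dual ℝ W)) ⊤ ⊤ = ⊤ :=
    TensorProduct.map₂_mk_top_top_eq_top ..
  rw [← hA, ← hB, Submodule.map₂_span_span] at h1
  have h2 := congrArg (Submodule.map (TensorProduct.dualDistrib ℝ V W)) h1
  have h3 : LinearMap.range (TensorProduct.dualDistrib ℝ V W) = ⊤ :=
    LinearMap.range_eq_top.2 (TensorProduct.dualDistribEquiv ℝ V W).surjective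
  rw [Submodule.map_span, Submodule.map_top, h3] at h2
  rw [← h2]
  refine Submodule.span_mono ?_
  rintro _ ⟨_, ⟨e, he, f, hf, rfl⟩, rfl⟩
  exact ⟨_, hM e he f hf, true, rfl⟩

theorem isInformationallyComplete_LOCCAtoB [FiniteDimensional ℝ V] [FiniteDimensional ℝ W]
    (hA : Submodule.span ℝ A.effects = ⊤) (hB : Submodule.span ℝ B.effects = ⊤) :
    IsInformationallyComplete (LOCCAtoB A B) := by
  refine isInformationallyComplete_of_prodFunctional (u := (A.minTensor B).unit) hA hB
    fun e he f hf => ?_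
  -- Answering the outcome `A.unit - e` with the zero effect leaves the single product `e ⊗ f`.
  have h := binary_mem_LOCCAtoB (f := fun b : Bool => cond b f 0) (isMeasurement_binary he)
    (fun b => by cases b; exacts [zero_mem_effects hf, hf])
  simpa [prodFunctional] using h

theorem isInformationallyComplete_LOCCBtoA [FiniteDimensional ℝ V] [FiniteDimensional ℝ W]
    (hA : Submodule.span ℝ A.effects = ⊤) (hB : Submodule.span ℝ B.effects = ⊤) :
    IsInformationallyComplete (LOCCBtoA A B) := by
  refine isInformationallyComplete_of_prodFunctional (u := (A.minTensor B).unit) hA hB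
    fun e he f hf => ?_
  have h := binary_mem_LOCCBtoA (e := fun b : Bool => cond b e 0)
    (fun b => by cases b; exacts [zero_mem_effects he, he]) (isMeasurement_binary hf)
  simpa [prodFunctional] using h

end Bipartite

/-! ### Measurements and spanning effects obtained from a design. -/

namespace IsDesign

variable {n : ℕ} {K : Type} [Fintype K] {P : K → Herm n} {w : K → ℝ}

theorem mem_cone (h : IsDesign P w) (k : K) : P k ∈ (QM n).cone := by
  have h1 : (P k : Matrix (Fin n) (Fin n) ℂ)
      = (P k : Matrix (Fin n) (Fin n) ℂ)ᴴ * (P k : Matrix (Fin n) (Fin n) ℂ) := by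
    rw [(P k).conjTranspose_coe, h.mul_self]
  rw [mem_QM_cone, h1]
  exact posSemidef_conjTranspose_mul_self _

theorem one_sub_mem_cone (h : IsDesign P w) (k : K) : 1 - P k ∈ (QM n).cone :=
  one_sub_mem_QM_cone (h.mul_self k)

theorem pairing_self (h : IsDesign P w) (k : K) : pairing n (P k) (P k) = 1 := by
  rw [pairing_apply, h.mul_self, ← QM_unit_apply, h.unit]

theorem pairing_one_sub (h : IsDesign P w) (k : K) : pairing n (P k) (1 - P k) = 0 := by
  rw [map_sub, h.pairing_self, pairing_one_right, h.unit, sub_self]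

theorem sum_mul_apply (h : IsDesign P w) (f : Module.Dual ℝ (Herm n)) :
    ∑ k, w k * f (P k) = ((n : ℝ) + 1) * f 1 := by
  have := congrArg f h.sum_smul
  rw [map_sum] at this
  simpa only [map_smul, smul_eq_mul] using this

theorem sum_mul_pairing (h : IsDesign P w) (a : Herm n) :
    ∑ k, w k * pairing n (P k) a = ((n : ℝ) + 1) * (QM n).unit a := by
  have := h.sum_mul_apply (pairing n a)
  simpa only [pairing_comm a, pairing_one_left] using this

theorem sum_mul_pairing_mul_apply (h : IsDesign P w) (a : Herm n) (f : Module.Dual ℝ (Herm n)) :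
    ∑ k, w k * pairing n (P k) a * f (P k) = (QM n).unit a * f 1 + f a := by
  have := congrArg f (h.sum_eq a)
  rw [map_sum] at this
  simpa only [map_smul, map_add, smul_eq_mul] using this

/-- The measurement whose effects are proportional to the projections of the design. -/
theorem isMeasurement (h : IsDesign P w) :
    (QM n).IsMeasurement fun k => (w k / ((n : ℝ) + 1)) • pairing n (P k) := by
  refine isMeasurement_of_mem_dualCone (fun k => smul_mem_dualCone
    (div_nonneg (h.nonneg k) (by positivity)) fun a ha => pairing_nonneg (h.mem_cone k) ha)
    (LinearMap.ext fun a => ?_)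
  have h1 := h.sum_mul_pairing a
  have h2 : ((n : ℝ) + 1) ≠ 0 := by positivity
  simp only [LinearMap.sum_apply, LinearMap.smul_apply, smul_eq_mul, div_mul_eq_mul_div,
    ← Finset.sum_div]
  rw [h1, mul_div_cancel_left₀ _ h2]

/-- Applying a functional `g` to the design identity expresses `g` through the pairings with the `P
k` and the unit. -/
theorem span_effects (h : IsDesign P w) : Submodule.span ℝ (QM n).effects = ⊤ := by
  have h2 : ((n : ℝ) + 1) ≠ 0 := by positivity
  have hP : ∀ k, pairing n (P k) ∈ Submodule.span ℝ (QM n).effects := fun k => by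
    refine Submodule.subset_span ⟨fun a ha => pairing_nonneg (h.mem_cone k) ha, fun a ha => ?_⟩
    have := pairing_nonneg (h.one_sub_mem_cone k) ha
    rwa [map_sub, LinearMap.sub_apply, pairing_one_left] at this
  have hu : (QM n).unit ∈ Submodule.span ℝ (QM n).effects := by
    rw [← h.isMeasurement.2]
    exact Submodule.sum_mem _ fun k _ => Submodule.smul_mem _ _ (hP k)
  refine eq_top_iff.2 fun g _ => ?_
  have hg : g = ∑ k, (w k * g (P k)) • pairing n (P k) - g 1 • (QM n).unit := by
    refine LinearMap.ext fun a => ?_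
    have := h.sum_mul_pairing_mul_apply a g
    simp only [LinearMap.sub_apply, LinearMap.sum_apply, LinearMap.smul_apply, smul_eq_mul]
    rw [eq_sub_iff_add_eq, mul_comm (g 1), add_comm, ← this]
    exact Finset.sum_congr rfl fun k _ => by ring
  rw [hg]
  exact Submodule.sub_mem _ (Submodule.sum_mem _ fun k _ => Submodule.smul_mem _ _ (hP k))
    (Submodule.smul_mem _ _ hu)

end IsDesign

theorem span_QM_effects {n : ℕ} (hn : 1 ≤ n) : Submodule.span ℝ (QM n).effects = ⊤ := by
  obtain ⟨K, _, P, w, h⟩ := exists_isDesign hn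
  exact h.span_effects

/-! ### Upper bound: noisy effects by one-way communication. -/

section Upper

variable {V : Type} [AddCommGroup V] [Module ℝ V] {B : GPTData V} {m : ℕ}

/-- Every effect on the minimal composite of an `m`-level quantum system with an arbitrary system
becomes implementable by one-way communication from the quantum system after mixing with noise. -/
theorem exists_local_decomposition (hm : 1 ≤ m) {e : Module.Dual ℝ (Herm m ⊗[ℝ] V)}
    (he : e ∈ ((QM m).minTensor B).effects) :
    ∃ (K : Type) (_ : Fintype K) (E : K → Module.Dual ℝ (Herm m)) (f : K → Module.Dual ℝ V),
      (QM m).IsMeasurement E ∧ (∀ k, f k ∈ B.effects) ∧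
      ∑ k, prodFunctional (E k) (f k)
        = (2 * (m : ℝ) - 1)⁻¹ • (((m : ℝ) - 1) • ((QM m).minTensor B).unit + e) := by
  obtain ⟨K, _, P, w, h⟩ := exists_isDesign hm
  have hm' : (1 : ℝ) ≤ m := by exact_mod_cast hm
  have hR : 0 < 2 * (m : ℝ) - 1 := by linarith
  have hpos : ∀ a ∈ (QM m).cone, ∀ b ∈ B.cone, 0 ≤ e (a ⊗ₜ b) := mem_dualCone_minTensor.1 he.1
  have hle : ∀ a ∈ (QM m).cone, ∀ b ∈ B.cone, e (a ⊗ₜ b) ≤ (QM m).unit a * B.unit b := by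
    intro a ha b hb
    have := mem_dualCone_minTensor.1 he.2 a ha b hb
    rwa [LinearMap.sub_apply, minTensor_unit_tmul, sub_nonneg] at this
  have hunit : ∀ k, (QM m).unit (1 - P k) = (m : ℝ) - 1 := fun k => by
    rw [map_sub, QM_unit_one, h.unit]
  -- Up to the factor `(2m-1)⁻¹`, the response is `(m+1) e(P k, ·) - e(1, ·) + (m-1) u`. The design
  -- sum of its first term is `Tr(a) e(1, ·) + e(a, ·)`, and the second removes `Tr(a) e(1, ·)`.
  -- Rewriting `e(1, ·)` as `e(P k, ·) + e(1 - P k, ·)` makes both bounds visible: `(m-1) u` just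
  -- covers `e(1 - P k, ·)`, and `m e(P k, ·) ≤ m u` gives the total `(2m-1) u`.
  refine ⟨K, inferInstance, fun k => (w k / ((m : ℝ) + 1)) • pairing m (P k),
    fun k => (2 * (m : ℝ) - 1)⁻¹ • ((m : ℝ) • TensorProduct.curry e (P k)
      + ((m : ℝ) - 1) • B.unit - TensorProduct.curry e (1 - P k)),
    h.isMeasurement, fun k => ⟨fun b hb => ?_, fun b hb => ?_⟩,
    TensorProduct.ext' fun a b => ?_⟩
  · have h1 := hpos _ (h.mem_cone k) b hb
    have h2 := hle _ (h.one_sub_mem_cone k) b hb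
    rw [hunit] at h2
    simp only [LinearMap.smul_apply, LinearMap.sub_apply, LinearMap.add_apply, smul_eq_mul,
      TensorProduct.curry_apply]
    refine mul_nonneg (inv_nonneg.2 hR.le) ?_
    have := mul_nonneg (zero_le_one.trans hm') h1
    linarith
  · have h1 := hle _ (h.mem_cone k) b hb
    have h2 := hpos _ (h.one_sub_mem_cone k) b hb
    rw [h.unit, one_mul] at h1
    simp only [LinearMap.smul_apply, LinearMap.sub_apply, LinearMap.add_apply, smul_eq_mul,
      TensorProduct.curry_apply]
    rw [sub_nonneg, inv_mul_le_iff₀ hR]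
    have := mul_le_mul_of_nonneg_left h1 (zero_le_one.trans hm')
    linarith
  · have h1 := h.sum_mul_pairing a
    have h2 := h.sum_mul_pairing_mul_apply a ((TensorProduct.curry e).flip b)
    have hm1 : (m : ℝ) + 1 ≠ 0 := by positivity
    simp only [LinearMap.flip_apply, TensorProduct.curry_apply] at h2
    have hterm : ∀ k, prodFunctional ((w k / ((m : ℝ) + 1)) • pairing m (P k))
        ((2 * (m : ℝ) - 1)⁻¹ • ((m : ℝ) • TensorProduct.curry e (P k)
          + ((m : ℝ) - 1) • B.unit - TensorProduct.curry e (1 - P k))) (a ⊗ₜ b)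
        = (2 * (m : ℝ) - 1)⁻¹ * (w k * pairing m (P k) a * e (P k ⊗ₜ b))
          + ((2 * (m : ℝ) - 1)⁻¹ * ((m : ℝ) + 1)⁻¹ * (((m : ℝ) - 1) * B.unit b - e (1 ⊗ₜ b)))
            * (w k * pairing m (P k) a) := by
      intro k
      simp only [prodFunctional_tmul, LinearMap.smul_apply, LinearMap.sub_apply,
        LinearMap.add_apply, smul_eq_mul, TensorProduct.curry_apply, map_sub]
      field_simp
      ring
    rw [LinearMap.sum_apply, Finset.sum_congr rfl fun k _ => hterm k, Finset.sum_add_distrib,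
      ← Finset.mul_sum, ← Finset.mul_sum, h1, h2]
    simp only [LinearMap.smul_apply, LinearMap.add_apply, smul_eq_mul, minTensor_unit_tmul]
    field_simp
    ring

theorem binary_noisy_mem_LOCCAtoB (hm : 1 ≤ m) {e : Module.Dual ℝ (Herm m ⊗[ℝ] V)}
    (he : e ∈ ((QM m).minTensor B).effects) :
    binary ((QM m).minTensor B).unit
      ((2 * (m : ℝ) - 1)⁻¹ • (((m : ℝ) - 1) • ((QM m).minTensor B).unit + e))
      ∈ LOCCAtoB (QM m) B := by
  obtain ⟨K, _, E, f, hE, hf, hs⟩ := exists_local_decomposition hm he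
  rw [← hs]
  exact binary_mem_LOCCAtoB hE hf

theorem binary_noisy_mem_LOCCBtoA (hm : 1 ≤ m) {e : Module.Dual ℝ (V ⊗[ℝ] Herm m)}
    (he : e ∈ (B.minTensor (QM m)).effects) :
    binary (B.minTensor (QM m)).unit
      ((2 * (m : ℝ) - 1)⁻¹ • (((m : ℝ) - 1) • (B.minTensor (QM m)).unit + e))
      ∈ LOCCBtoA B (QM m) := by
  -- Swapping the tensor factors reduces to communication in the other direction.
  have he' : e ∘ₗ (TensorProduct.comm ℝ (Herm m) V).toLinearMap
      ∈ ((QM m).minTensor B).effects := by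
    refine ⟨mem_dualCone_minTensor.2 fun a ha b hb => ?_,
      mem_dualCone_minTensor.2 fun a ha b hb => ?_⟩
    · exact mem_dualCone_minTensor.1 he.1 b hb a ha
    · have := mem_dualCone_minTensor.1 he.2 b hb a ha
      rw [LinearMap.sub_apply, minTensor_unit_tmul, mul_comm] at this
      rw [LinearMap.sub_apply, minTensor_unit_tmul]
      exact this
  obtain ⟨K, _, E, f, hE, hf, hs⟩ := exists_local_decomposition hm he'
  have hs' : ∑ k, prodFunctional (f k) (E k)
      = (2 * (m : ℝ) - 1)⁻¹ • (((m : ℝ) - 1) • (B.minTensor (QM m)).unit + e) := by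
    refine TensorProduct.ext' fun b a => ?_
    have := LinearMap.congr_fun hs (a ⊗ₜ b)
    simp only [LinearMap.sum_apply, prodFunctional_tmul, LinearMap.smul_apply,
      LinearMap.add_apply, minTensor_unit_tmul, LinearMap.comp_apply, LinearEquiv.coe_coe,
      TensorProduct.comm_tmul] at this ⊢
    simp only [mul_comm (f _ b), mul_comm (B.unit b)]
    exact this
  rw [← hs']
  exact binary_mem_LOCCBtoA hf hE

end Upper

/-! ### Lower bound: hiding states built from the flip. -/

section Lower

variable {n nA nB : ℕ}

theorem smul_mem_QM_cone {c : ℝ} (hc : 0 ≤ c) {a : Herm n} (ha : a ∈ (QM n).cone) :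
    c • a ∈ (QM n).cone := by
  have h : ((c • a : Herm n) : Matrix (Fin n) (Fin n) ℂ)
      = (c : ℂ) • (a : Matrix (Fin n) (Fin n) ℂ) := by
    ext i j; simp [selfAdjoint.val_smul]
  rw [mem_QM_cone, h]
  exact (mem_QM_cone.1 ha).smul (Complex.zero_le_real.2 hc)

theorem tmul_mem_W_cone {a : Herm nA} {b : Herm nB} (ha : a ∈ (QM nA).cone)
    (hb : b ∈ (QM nB).cone) : a ⊗ₜ b ∈ (W nA nB).cone :=
  subset_convexHull ℝ _ ⟨a, ha, b, hb, rfl⟩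

theorem smul_mem_W_cone {c : ℝ} (hc : 0 ≤ c) {z : Herm nA ⊗[ℝ] Herm nB}
    (hz : z ∈ (W nA nB).cone) : c • z ∈ (W nA nB).cone := by
  refine smul_mem_convexHull ?_ hc hz
  rintro c hc _ ⟨a, ha, b, hb, rfl⟩
  exact ⟨c • a, smul_mem_QM_cone hc ha, b, hb, (TensorProduct.smul_tmul' c a b)⟩

theorem sum_mem_W_cone {ι : Type} {s : Finset ι} {z : ι → Herm nA ⊗[ℝ] Herm nB}
    (hz : ∀ i ∈ s, z i ∈ (W nA nB).cone) : ∑ i ∈ s, z i ∈ (W nA nB).cone := by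
  refine sum_mem_convexHull ?_ ?_ hz
  · rintro c hc _ ⟨a, ha, b, hb, rfl⟩
    exact ⟨c • a, smul_mem_QM_cone hc ha, b, hb, (TensorProduct.smul_tmul' c a b)⟩
  · exact ⟨0, PosSemidef.zero, 0, PosSemidef.zero, by simp⟩

/-- The functional `a ⊗ b ↦ Tr (V_A* a V_A V_B* b V_B)`; for `V_A = V_B = 1` it is the flip. -/
def flipEffect (VA : Matrix (Fin nA) (Fin n) ℂ) (VB : Matrix (Fin nB) (Fin n) ℂ) :
    Module.Dual ℝ (Herm nA ⊗[ℝ] Herm nB) :=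
  TensorProduct.lift ((pairing n).compl₁₂ (conjBy VAᴴ) (conjBy VBᴴ))

theorem flipEffect_tmul (VA : Matrix (Fin nA) (Fin n) ℂ) (VB : Matrix (Fin nB) (Fin n) ℂ)
    (a : Herm nA) (b : Herm nB) :
    flipEffect VA VB (a ⊗ₜ b) = pairing n (conjBy VAᴴ a) (conjBy VBᴴ b) := rfl

variable {VA : Matrix (Fin nA) (Fin n) ℂ} {VB : Matrix (Fin nB) (Fin n) ℂ}

theorem flipEffect_mem_effects (hA : VAᴴ * VA = 1) (hB : VBᴴ * VB = 1) :
    flipEffect VA VB ∈ (W nA nB).effects := by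
  refine ⟨mem_dualCone_minTensor.2 fun a ha b hb => ?_,
    mem_dualCone_minTensor.2 fun a ha b hb => ?_⟩
  · exact pairing_nonneg (conjBy_mem_cone _ ha) (conjBy_mem_cone _ hb)
  · have h1 : (W nA nB).unit (a ⊗ₜ b) = (QM nA).unit a * (QM nB).unit b :=
      minTensor_unit_tmul a b
    rw [LinearMap.sub_apply, h1, sub_nonneg, flipEffect_tmul]
    refine (pairing_le (conjBy_mem_cone _ ha) (conjBy_mem_cone _ hb)).trans ?_
    exact mul_le_mul (QM_unit_conjBy_conjTranspose_le hA ha)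
      (QM_unit_conjBy_conjTranspose_le hB hb) (QM_unit_nonneg (conjBy_mem_cone _ hb))
      (QM_unit_nonneg ha)

/-- For `p = 1` the second state has weight zero, so any state serves; this happens when `n = 1`. -/
theorem exists_state_smul_eq {p : ℝ} (hp : p ≤ 1) {y ρ : Herm nA ⊗[ℝ] Herm nB}
    (hρ : ρ ∈ (W nA nB).states) (hy : y ∈ (W nA nB).cone) (hunit : (W nA nB).unit y = 1 - p)
    (h0 : p = 1 → y = 0) : ∃ σ ∈ (W nA nB).states, (1 - p) • σ = y := by
  by_cases h : p = 1
  · exact ⟨ρ, hρ, by rw [h0 h, h]; simp⟩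
  · have h1 : 1 - p ≠ 0 := sub_ne_zero.2 (Ne.symm h)
    refine ⟨(1 - p)⁻¹ • y, ⟨smul_mem_W_cone (inv_nonneg.2 (sub_nonneg.2 hp)) hy, ?_⟩, ?_⟩
    · rw [map_smul, hunit, smul_eq_mul, inv_mul_cancel₀ h1]
    · rw [smul_smul, mul_inv_cancel₀ h1, one_smul]

/-- A pair of states of the `W`-theory that is perfectly distinguishable, while its weighted
difference is positive on all separable effects. -/
theorem exists_hiding_states (hn : 1 ≤ n) (hnA : n ≤ nA) (hnB : n ≤ nB) :
    ∃ ρ ∈ (W nA nB).states, ∃ σ ∈ (W nA nB).states, ∃ p ∈ Set.Icc (0 : ℝ) 1,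
      ∃ e ∈ (W nA nB).effects,
        2 * e (p • ρ - (1 - p) • σ) - (W nA nB).unit (p • ρ - (1 - p) • σ) = 1 ∧
        (W nA nB).unit (p • ρ - (1 - p) • σ) = 1 / (2 * (n : ℝ) - 1) ∧
        ∀ g ∈ separableEffectCone (QM nA) (QM nB), 0 ≤ g (p • ρ - (1 - p) • σ) := by
  obtain ⟨K, _, P, w, h⟩ := exists_isDesign hn
  obtain ⟨VA, hVA⟩ := exists_isometry hnA
  obtain ⟨VB, hVB⟩ := exists_isometry hnB
  have hn' : (1 : ℝ) ≤ n := by exact_mod_cast hn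
  have hn0 : (n : ℝ) ≠ 0 := by positivity
  have hn1 : (n : ℝ) + 1 ≠ 0 := by positivity
  have hR : 0 < 2 * (n : ℝ) - 1 := by linarith
  have hR' : (2 * (n : ℝ) - 1) ≠ 0 := hR.ne'
  have hunit : ∀ (a : Herm nA) (b : Herm nB),
      (W nA nB).unit (a ⊗ₜ b) = (QM nA).unit a * (QM nB).unit b := minTensor_unit_tmul
  -- By the design identity, `S` and `T` are the embedded `1 + F` and `n·1 - F`, with `F` the flip;
  -- the sums display them as separable.
  set S : Herm nA ⊗[ℝ] Herm nB := ∑ k, w k • (conjBy VA (P k) ⊗ₜ conjBy VB (P k)) with hS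
  set T : Herm nA ⊗[ℝ] Herm nB := ∑ k, w k • (conjBy VA (P k) ⊗ₜ conjBy VB (1 - P k)) with hT
  have hScone : S ∈ (W nA nB).cone := sum_mem_W_cone fun k _ => smul_mem_W_cone (h.nonneg k)
    (tmul_mem_W_cone (conjBy_mem_cone _ (h.mem_cone k)) (conjBy_mem_cone _ (h.mem_cone k)))
  have hTcone : T ∈ (W nA nB).cone := sum_mem_W_cone fun k _ => smul_mem_W_cone (h.nonneg k)
    (tmul_mem_W_cone (conjBy_mem_cone _ (h.mem_cone k)) (conjBy_mem_cone _ (h.one_sub_mem_cone k)))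
  have hSunit : (W nA nB).unit S = n * ((n : ℝ) + 1) := by
    rw [hS, map_sum, ← h.sum_weight]
    refine Finset.sum_congr rfl fun k _ => ?_
    rw [map_smul, hunit, QM_unit_conjBy hVA, QM_unit_conjBy hVB, h.unit, mul_one, smul_eq_mul,
      mul_one]
  have hTunit : (W nA nB).unit T = n * ((n : ℝ) + 1) * (n - 1) := by
    rw [hT, map_sum, ← h.sum_weight, Finset.sum_mul]
    refine Finset.sum_congr rfl fun k _ => ?_
    rw [map_smul, hunit, QM_unit_conjBy hVA, QM_unit_conjBy hVB, map_sub, QM_unit_one, h.unit,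
      one_mul, smul_eq_mul]
  have hSflip : flipEffect VA VB S = n * ((n : ℝ) + 1) := by
    rw [hS, map_sum, ← h.sum_weight]
    refine Finset.sum_congr rfl fun k _ => ?_
    rw [map_smul, flipEffect_tmul, conjBy_conjTranspose_conjBy hVA,
      conjBy_conjTranspose_conjBy hVB, h.pairing_self, smul_eq_mul, mul_one]
  have hTflip : flipEffect VA VB T = 0 := by
    rw [hT, map_sum]
    refine Finset.sum_eq_zero fun k _ => ?_
    rw [map_smul, flipEffect_tmul, conjBy_conjTranspose_conjBy hVA,
      conjBy_conjTranspose_conjBy hVB, h.pairing_one_sub, smul_zero]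
  -- Since `T` has `n - 1` times the unit value of `S`, this prior makes the weighted difference
  -- proportional to `n S - T`, where the identity parts cancel and `(n+1) F` remains.
  set p : ℝ := n / (2 * n - 1) with hp
  have hp0 : 0 ≤ p := by positivity
  have hp1 : p ≤ 1 := by rw [hp, div_le_one hR]; linarith
  have hρ : (n * ((n : ℝ) + 1))⁻¹ • S ∈ (W nA nB).states := by
    refine ⟨smul_mem_W_cone (by positivity) hScone, ?_⟩
    rw [map_smul, hSunit, smul_eq_mul, inv_mul_cancel₀ (mul_ne_zero hn0 hn1)]
  have hT0 : p = 1 → T = 0 := by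
    intro hp'
    rw [hp, div_eq_one_iff_eq hR'] at hp'
    have hn2 : (n : ℝ) = 1 := by linarith
    refine Finset.sum_eq_zero fun k _ => ?_
    have hz : (QM n).unit (1 - P k) = 0 := by rw [map_sub, QM_unit_one, h.unit, hn2, sub_self]
    have hz' : (1 - P k) = 0 := by
      have := (h.one_sub_mem_cone k : PosSemidef _).trace_eq_zero_iff.1
        (by rw [← ofReal_QM_unit, hz]; rfl)
      exact Subtype.ext this
    rw [hz', map_zero, TensorProduct.tmul_zero, smul_zero]
  obtain ⟨σ, hσ, hσT⟩ := exists_state_smul_eq (y := (n * ((n : ℝ) + 1) * (2 * n - 1))⁻¹ • T)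
    hp1 hρ (smul_mem_W_cone (by positivity) hTcone)
    (by
      rw [map_smul, hTunit, smul_eq_mul, hp, one_sub_div hR', inv_mul_eq_div,
        div_eq_div_iff (mul_ne_zero (mul_ne_zero hn0 hn1) hR') hR']
      ring)
    (fun h' => by rw [hT0 h', smul_zero])
  refine ⟨_, hρ, σ, hσ, p, ⟨hp0, hp1⟩, flipEffect VA VB, flipEffect_mem_effects hVA hVB, ?_⟩
  have hx : p • ((n * ((n : ℝ) + 1))⁻¹ • S) - (1 - p) • σ
      = (n * ((n : ℝ) + 1) * (2 * n - 1))⁻¹ • ((n : ℝ) • S - T) := by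
    rw [hσT, smul_sub, smul_smul, smul_smul, hp]
    congr 2
    field_simp
  rw [hx]
  have hxunit : (W nA nB).unit ((n * ((n : ℝ) + 1) * (2 * n - 1))⁻¹ • ((n : ℝ) • S - T))
      = 1 / (2 * n - 1) := by
    rw [map_smul, map_sub, map_smul, hSunit, hTunit]
    simp only [smul_eq_mul]
    field_simp
    ring
  refine ⟨?_, hxunit, fun g hg => ?_⟩
  · rw [hxunit, map_smul, map_sub, map_smul, hSflip, hTflip]
    simp only [smul_eq_mul]
    field_simp
    ring
  · rw [map_smul]
    refine mul_nonneg (by positivity) ?_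
    refine convexHull_min (t := {g : Module.Dual ℝ _ | 0 ≤ g ((n : ℝ) • S - T)}) ?_
      (convex_halfSpace_ge (LinearMap.applyₗ ((n : ℝ) • S - T)).isLinear 0) hg
    rintro _ ⟨e, he, f, hf, rfl⟩
    rw [Set.mem_ofPred_eq]
    -- Self-duality represents the pulled-back functional by a positive matrix `b`, on which `e ∘ₗ
    -- conjBy VA` can be evaluated.
    obtain ⟨b, hb⟩ := exists_pairing_eq (f ∘ₗ conjBy VB)
    have hbcone : b ∈ (QM n).cone := mem_QM_cone_of_pairing_mem_dualCone fun a ha => by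
      rw [hb]; exact hf _ (conjBy_mem_cone _ ha)
    have hfb : ∀ a, f (conjBy VB a) = pairing n a b := fun a => by
      rw [pairing_comm, hb]; rfl
    have h1 := h.sum_mul_pairing_mul_apply b (e ∘ₗ conjBy VA)
    have h2 := h.sum_mul_apply (e ∘ₗ conjBy VA)
    simp only [LinearMap.comp_apply] at h1 h2
    have hSv : prodFunctional e f S = (QM n).unit b * e (conjBy VA 1) + e (conjBy VA b) := by
      rw [← h1, hS, map_sum]
      refine Finset.sum_congr rfl fun k _ => ?_
      rw [map_smul, prodFunctional_tmul, hfb, smul_eq_mul]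
      ring
    have hTv : prodFunctional e f T = (QM n).unit b * (((n : ℝ) + 1) * e (conjBy VA 1))
        - prodFunctional e f S := by
      rw [← h2, hS, hT, map_sum, map_sum, Finset.mul_sum, ← Finset.sum_sub_distrib]
      refine Finset.sum_congr rfl fun k _ => ?_
      rw [map_smul, map_smul, prodFunctional_tmul, prodFunctional_tmul, map_sub, map_sub, hfb, hfb,
        pairing_one_left, smul_eq_mul, smul_eq_mul]
      ring
    have hval : prodFunctional e f ((n : ℝ) • S - T) = ((n : ℝ) + 1) * e (conjBy VA b) := by
      rw [map_sub, map_smul, hTv, hSv, smul_eq_mul]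
      ring
    rw [hval]
    exact mul_nonneg (by positivity) (he _ (conjBy_mem_cone _ hbcone))

end Lower

/-- Sets of separable measurements that implement every noisy effect have the data hiding ratio
determined by the noise. -/
theorem isDataHidingRatio_W {n nA nB : ℕ} (hn : 1 ≤ n) (hnA : n ≤ nA) (hnB : n ≤ nB)
    {M : Set (FinFamily (Herm nA ⊗[ℝ] Herm nB))} (hM : M ⊆ SEP (QM nA) (QM nB))
    (hic : IsInformationallyComplete M)
    (hup : ∀ e ∈ (W nA nB).effects, binary (W nA nB).unit
      ((2 * (n : ℝ) - 1)⁻¹ • (((n : ℝ) - 1) • (W nA nB).unit + e)) ∈ M) :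
    (W nA nB).IsDataHidingRatio M (2 * (n : ℝ) - 1) := by
  obtain ⟨ρ, hρ, σ, hσ, p, hp, e, he, h1, h2, h3⟩ := exists_hiding_states hn hnA hnB
  exact isDataHidingRatio_of (fun F hF => (hM hF).1) hic (by exact_mod_cast hn) hup hρ hσ hp he
    h1 h2 fun F hF i => h3 _ ((hM hF).2 i)

end WTheory
end

theorem mainTheorem6 (nA nB : ℕ) (hA : 1 ≤ nA) (hB : 1 ≤ nB) :
    (WTheory.W nA nB).IsDataHidingRatio (WTheory.SEP (WTheory.QM nA) (WTheory.QM nB))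
        (2 * ((min nA nB : ℕ) : ℝ) - 1) ∧
    (nA ≤ nB →
      (WTheory.W nA nB).IsDataHidingRatio (WTheory.LOCCAtoB (WTheory.QM nA) (WTheory.QM nB))
        (2 * ((min nA nB : ℕ) : ℝ) - 1)) ∧
    (nB ≤ nA →
      (WTheory.W nA nB).IsDataHidingRatio (WTheory.LOCCBtoA (WTheory.QM nA) (WTheory.QM nB))
        (2 * ((min nA nB : ℕ) : ℝ) - 1)) := by
  have icA := WTheory.isInformationallyComplete_LOCCAtoB (WTheory.span_QM_effects hA)
    (WTheory.span_QM_effects hB)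
  have icB := WTheory.isInformationallyComplete_LOCCBtoA (WTheory.span_QM_effects hA)
    (WTheory.span_QM_effects hB)
  refine ⟨?_, fun h => ?_, fun h => ?_⟩
  -- `SEP` contains both one-way classes, so the noisy effects come from the direction starting at
  -- the smaller system.
  · rcases le_total nA nB with h | h
    · rw [min_eq_left h]
      exact WTheory.isDataHidingRatio_W hA le_rfl h subset_rfl
        (icA.mono WTheory.LOCCAtoB_subset_SEP) fun e he =>
          WTheory.LOCCAtoB_subset_SEP (WTheory.binary_noisy_mem_LOCCAtoB hA he)
    · rw [min_eq_right h]
      exact WTheory.isDataHidingRatio_W hB h le_rfl subset_rfl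
        (icA.mono WTheory.LOCCAtoB_subset_SEP) fun e he =>
          WTheory.LOCCBtoA_subset_SEP (WTheory.binary_noisy_mem_LOCCBtoA hB he)
  · rw [min_eq_left h]
    exact WTheory.isDataHidingRatio_W hA le_rfl h WTheory.LOCCAtoB_subset_SEP icA fun e he =>
      WTheory.binary_noisy_mem_LOCCAtoB hA he
  · rw [min_eq_right h]
    exact WTheory.isDataHidingRatio_W hB h le_rfl WTheory.LOCCBtoA_subset_SEP icB fun e he =>
      WTheory.binary_noisy_mem_LOCCBtoA hB he
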